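/- Let $[z]=z-z^{-1}$, let $N\ge 0$ be an integer, let $q\in\mathbb C^\times$ with $q^4\neq 1$, and fix a square root $s=\sqrt{[q][q^2]}$. In the basis $|{\uparrow\Uparrow}\rangle,|{\uparrow 0}\rangle,|{\uparrow\Downarrow}\rangle,|{\downarrow\Uparrow}\rangle,|{\downarrow 0}\rangle,|{\downarrow\Downarrow}\rangle$ of $\mathbb C^2\otimes\mathbb C^3$ let $$R(z)=\begin{pmatrix}[q^2z]&0&0&0&0&0\\0&[qz]&0&s&0&0\\0&0&[z]&0&s&0\\0&s&0&[z]&0&0\\0&0&s&0&[qz]&0\\0&0&0&0&0&[q^2z]\end{pmatrix}.$$ For $w_1,\dots,w_N\in\mathbb C^\times$ define on $\mathbb C^2\otimes(\mathbb C^3)^{\otimes N}$ (with auxiliary space $a=\mathbb C^2$) the monodromy matrix of the ten-vertex model $$\mathcal T_a(z)=R_{a,N}(q^{-1}z/w_N)\cdots R_{a,1}(q^{-1}z/w_1)=\begin{pmatrix}\mathcal A(z)&\mathcal B(z)\\ \mathcal C(z)&\mathcal D(z)\end{pmatrix}_{a}$$ and the transfer matrix with anti-diagonal twist $$T^{(1)}(z)=\mathrm{tr}_a\Big(\begin{pmatrix}0&\mathrm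 i\\ \mathrm i&0\end{pmatrix}_{a}\mathcal T_a(z)\Big)=\mathrm i\big(\mathcal B(z)+\mathcal C(z)\big),\qquad z\in\mathbb C^\times .$$ Put $a(z)=\prod_{i=1}^N[qz/w_i]$, $d(z)=\prod_{i=1}^N[q^{-1}z/w_i]$ and $|\wedge\rangle=|{\Uparrow\cdots\Uparrow}\rangle$, with dual basis covector $\langle\wedge|$. For $\boldsymbol h=(h_1,\dots,h_N)\in\{0,1,2\}^N$ the separation-of-variables (height) states and their duals are $$\|\boldsymbol h\rangle\rangle=\prod_{j=1}^N\prod_{l=0}^{h_j-1}\frac{\mathcal B(q^{1-l}w_j)}{a(q^{1-l}w_j)}\,|\wedge\rangle,\qquad \langle\langle\boldsymbol h\|=\langle\wedge|\prod_{j=1}^N\prod_{l=0}^{h_j-1}\frac{\mathcal C(q^{1-l}w_j)}{d(q^{-l}w_j)} .$$ (The operators $\mathcal B$ commute among themselves, and so do the operators $\mathcal C$, so the order of the factors does not matter.) (1) Suppose that $w_i^2\ne q^{2m}w_j^2$ for all $i\neq j$ and all $m\in\{-2,-1,0,1,2\}$. Then the states $\|\boldsymbol h\rangle\rangle$ are a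 basis of $(\mathbb C^3)^{\otimes N}$ and the states $\langle\langle\boldsymbol h\|$ are a basis of its dual. The space of covectors $\langle\varphi|$ with $\langle\varphi|T^{(1)}(z)=0$ for all $z\in\mathbb C^\times$ and the space of vectors $|v\rangle$ with $T^{(1)}(z)|v\rangle=0$ for all $z\in\mathbb C^\times$ are both one-dimensional. They are spanned, respectively, by a covector $\langle\psi_{AD}|$ and a vector $|\psi_{AD}\rangle$ such that, for all $\boldsymbol h\in\{0,1,2\}^N$, $$\langle\psi_{AD}\|\boldsymbol h\rangle\rangle=\prod_{i,j=1}^N\frac{[q^{1-h_i}w_i/w_j]}{[qw_i/w_j]},\qquad \langle\langle\boldsymbol h\|\psi_{AD}\rangle=\prod_{i,j=1}^N\frac{[q^{2(h_i-1)}w_i/w_j]}{[q^{-2}w_i/w_j]} .$$ (2) For generic inhomogeneities, $0$ is a simple eigenvalue of the matrix $T^{(1)}(z)$ for generic $z$: there is a non-zero polynomial $P\in\mathbb C[x_1,\dots,x_N]$ such that, if in addition to the condition in (1) $P(w_1,\dots,w_N)\neq0$, then for all but finitely many $z\in\mathbb C^\times$ the eigenvalue $0$ of $T^{(1)}(z)$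 has algebraic multiplicity one. -/

import Mathlib

open scoped Matrix Kronecker

noncomputable section

namespace TenVertex

/-- The short-hand notation `[z] = z - z⁻¹`. -/
def br (z : ℂ) : ℂ := z - z⁻¹

/-- Configurations of `N` spins one: `0, 1, 2` stand for `⇑, 0, ⇓`.  They label the canonical
basis of `(ℂ³)^{⊗N}`, whose vectors and covectors are represented by their components
`Conf N → ℂ`; a covector `φ` is paired with a vector `v` bilinearly, by `φ ⬝ᵥ v`. -/
abbrev Conf (N : ℕ) : Type := Fin N → Fin 3

/-- The row and column labels of `R`, in the order `↑⇑, ↑0, ↑⇓, ↓⇑, ↓0, ↓⇓`. -/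
def pairIndex (p : Fin 2 × Fin 3) : Fin 6 := finProdFinEquiv p

/-- The `R`-matrix `R^{(1,2)}(z)` of the ten-vertex model on `ℂ² ⊗ ℂ³`; here `s` is the chosen
square root of `[q][q²]`. -/
def R12 (q s z : ℂ) : Matrix (Fin 2 × Fin 3) (Fin 2 × Fin 3) ℂ :=
  (!![br (q ^ 2 * z), 0, 0, 0, 0, 0;
      0, br (q * z), 0, s, 0, 0;
      0, 0, br z, 0, s, 0;
      0, s, 0, br z, 0, 0;
      0, 0, s, 0, br (q * z), 0;
      0, 0, 0, 0, 0, br (q ^ 2 * z)] : Matrix (Fin 6) (Fin 6) ℂ).submatrix pairIndex pairIndex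

/-- The operator on `ℂ² ⊗ (ℂ³)^{⊗N}` that acts as `R` on the auxiliary space and the `j`-th factor
and as the identity on the other factors. -/
def onSite {N : ℕ} (j : Fin N) (R : Matrix (Fin 2 × Fin 3) (Fin 2 × Fin 3) ℂ) :
    Matrix (Fin 2 × Conf N) (Fin 2 × Conf N) ℂ :=
  Matrix.of fun a b =>
    if ∀ k, k ≠ j → a.2 k = b.2 k then R (a.1, a.2 j) (b.1, b.2 j) else 0

section

variable {N : ℕ} (q s : ℂ) (w : Fin N → ℂ)

/-- The monodromy matrix
`R_{a,N}(q⁻¹z/w_N) R_{a,N-1}(q⁻¹z/w_{N-1}) ⋯ R_{a,1}(q⁻¹z/w_1)`. -/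
def monodromy (z : ℂ) : Matrix (Fin 2 × Conf N) (Fin 2 × Conf N) ℂ :=
  (List.ofFn fun j : Fin N => onSite j (R12 q s (q⁻¹ * z / w j))).reverse.prod

/-- The upper right block `𝓑(z)` of the monodromy matrix. -/
def opB (z : ℂ) : Matrix (Conf N) (Conf N) ℂ :=
  Matrix.of fun σ τ => monodromy q s w z (0, σ) (1, τ)

/-- The lower left block `𝓒(z)` of the monodromy matrix. -/
def opC (z : ℂ) : Matrix (Conf N) (Conf N) ℂ :=
  Matrix.of fun σ τ => monodromy q s w z (1, σ) (0, τ)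

/-- The anti-diagonal twist matrix on the auxiliary space. -/
def twistAD : Matrix (Fin 2) (Fin 2) ℂ := !![0, Complex.I; Complex.I, 0]

/-- The trace over the auxiliary space. -/
def trAux (X : Matrix (Fin 2 × Conf N) (Fin 2 × Conf N) ℂ) : Matrix (Conf N) (Conf N) ℂ :=
  Matrix.of fun σ τ => ∑ α, X (α, σ) (α, τ)

/-- The transfer matrix `T^{(1)}(z)` of the ten-vertex model with anti-diagonal twist. -/
def transferAD (z : ℂ) : Matrix (Conf N) (Conf N) ℂ :=
  trAux ((twistAD ⊗ₖ (1 : Matrix (Conf N) (Conf N) ℂ)) * monodromy q s w z)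

/-- `a(z) = ∏ᵢ [q z / wᵢ]`. -/
def aFun (z : ℂ) : ℂ := ∏ i, br (q * z / w i)

/-- `d(z) = ∏ᵢ [q⁻¹ z / wᵢ]`. -/
def dFun (z : ℂ) : ℂ := ∏ i, br (q⁻¹ * z / w i)

/-- The canonical basis vector labelled by `⇑ ⋯ ⇑`; also the components of its dual covector. -/
def allUp (N : ℕ) : Conf N → ℂ := Pi.single (fun _ => 0) 1

/-- The height state
`‖h⟩⟩ = ∏_j ∏_{l=0}^{h_j-1} (𝓑(q^{1-l} w_j) / a(q^{1-l} w_j)) |⇑ ⋯ ⇑⟩`.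
The operators `𝓑` commute with each other, so the order of the factors is immaterial; here `j`
and `l` increase from left to right. -/
def heightKet (h : Fin N → Fin 3) : Conf N → ℂ :=
  (List.ofFn fun j : Fin N =>
    ((List.range (h j)).map fun l : ℕ =>
      (aFun q w (q ^ (1 - (l : ℤ)) * w j))⁻¹ • opB q s w (q ^ (1 - (l : ℤ)) * w j)).prod).prod
    *ᵥ allUp N

/-- The dual height state
`⟨⟨h‖ = ⟨⇑ ⋯ ⇑| ∏_j ∏_{l=0}^{h_j-1} (𝓒(q^{1-l} w_j) / d(q^{-l} w_j))`,
with the same ordering convention (the operators `𝓒` commute with each other). -/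
def heightBra (h : Fin N → Fin 3) : Conf N → ℂ :=
  allUp N ᵥ*
    (List.ofFn fun j : Fin N =>
      ((List.range (h j)).map fun l : ℕ =>
        (dFun q w (q ^ (-(l : ℤ)) * w j))⁻¹ • opC q s w (q ^ (1 - (l : ℤ)) * w j)).prod).prod

/-- Inhomogeneity parameters for which the height states are well defined and independent:
they are non-zero and `w_i² ≠ q^{2m} w_j²` for `i ≠ j` and `m = -2, …, 2`. -/
def GenericInhom : Prop :=
  (∀ i, w i ≠ 0) ∧
    ∀ i j, i ≠ j → ∀ m : ℤ, |m| ≤ 2 → w i ^ 2 ≠ q ^ (2 * m) * w j ^ 2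

end

end TenVertex

end

/-!
Left null vectors. The transfer matrix is `i (𝓑 + 𝓒)`. On a height state
`𝓑 (q ^ (1 - h j) * w j)` raises `h j` by one, up to a scalar, and vanishes if `h j = 2`; the
Yang–Baxter algebra together with the quantum determinant shows that `𝓒` at the same point
annihilates the state if `h j = 0` and lowers `h j` otherwise. A trigonometric polynomial of the
degree of `𝓑 + 𝓒` is determined by its values at `N` nodes, so `φ` is a null covector precisely
if, site by site, its component at `h j = 1` vanishes and its components at `h j = 2` and
`h j = 0` have the ratio `d (w j) / a (w j)`; this determines `φ` up to a scalar. Transposition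
exchanges `𝓑` with `𝓒` and kets with bras, so it yields the right null vectors.

Simplicity. The transfer matrices commute. Let `φ` and `ψ` be the left and right null vectors. If
`φ ⬝ᵥ ψ ≠ 0`, then the hyperplane `φ = 0` is invariant and contains no common null vector, so the
finitely many joint eigenvalues on it are non-zero trigonometric polynomials in `z`, and away
from their zeros the eigenvalue `0` comes from `ψ` alone. The overlap `φ ⬝ᵥ ψ` is a sum, over the
subsets of sites with height `2`, of rational functions of the inhomogeneities; it is not
identically zero because all terms tend to `1` at `w i = t ^ i`, `t → 0`.
-/

namespace TenVertex

theorem br_one : br 1 = 0 := by simp [br]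

theorem br_inv (z : ℂ) : br z⁻¹ = -br z := by simp [br]

theorem br_inv_mul_div (a x y : ℂ) : br (a⁻¹ * x / y) = -br (a * y / x) := by
  rw [← br_inv, inv_div, div_eq_mul_inv, div_eq_mul_inv, mul_inv]
  ring_nf

theorem br_eq_zero_iff {z : ℂ} (hz : z ≠ 0) : br z = 0 ↔ z ^ 2 = 1 := by
  rw [br, sub_eq_zero, ← mul_eq_one_iff_eq_inv₀ hz, sq]

theorem br_div_ne_zero {u v : ℂ} (hu : u ≠ 0) (hv : v ≠ 0) (h : u ^ 2 ≠ v ^ 2) :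
    br (u / v) ≠ 0 := by
  rwa [Ne, br_eq_zero_iff (div_ne_zero hu hv), div_pow, div_eq_one_iff_eq (pow_ne_zero _ hv)]

theorem br_zpow_ne_zero {q : ℂ} (hq : q ≠ 0) (hq4 : q ^ 4 ≠ 1) {m : ℤ}
    (hm : m ∣ 2) : br (q ^ m) ≠ 0 := by
  obtain ⟨k, hk⟩ := hm
  have hpow : q ^ 4 = ((q ^ m) ^ 2) ^ k := by
    have hfour : m * ((2 : ℕ) * k) = (4 : ℕ) := by
      rw [mul_left_comm, ← hk]
      rfl
    rw [← zpow_natCast (q ^ m), ← zpow_mul, ← zpow_mul, hfour, zpow_natCast]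
  rw [Ne, br_eq_zero_iff (zpow_ne_zero m hq)]
  exact fun h => hq4 (by rw [hpow, h, one_zpow])

/-! ### Trigonometric polynomials of definite parity -/

/-- The trigonometric polynomials with `n` terms: the functions which on `ℂ \ {0}` are linear
combinations of the monomials `z^(1-n), z^(3-n), …, z^(n-1)`.  Nothing is required of the value
at `0`. -/
def trigPoly (n : ℕ) : Submodule ℂ (ℂ → ℂ) where
  carrier := {f | ∃ p ∈ Polynomial.degreeLT ℂ n, ∀ z ≠ 0, z ^ n * f z = z * p.eval (z ^ 2)}
  zero_mem' := ⟨0, zero_mem _, by simp⟩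
  add_mem' := by
    rintro f g ⟨p, hp, hf⟩ ⟨p', hp', hg⟩
    exact ⟨p + p', add_mem hp hp', fun z hz => by
      rw [Pi.add_apply, mul_add, hf z hz, hg z hz, Polynomial.eval_add, mul_add]⟩
  smul_mem' := by
    rintro c f ⟨p, hp, hf⟩
    exact ⟨c • p, Submodule.smul_mem _ c hp, fun z hz => by
      rw [Pi.smul_apply, mul_smul_comm, hf z hz, Polynomial.eval_smul, mul_smul_comm]⟩

section TrigPoly

variable {m n : ℕ} {f g : ℂ → ℂ}

theorem mul_mem_trigPoly (hf : f ∈ trigPoly (m + 1)) (hg : g ∈ trigPoly n) :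
    f * g ∈ trigPoly (m + n) := by
  obtain ⟨p, hp, hpf⟩ := hf
  obtain ⟨p', hp', hpg⟩ := hg
  refine ⟨p * p', ?_, fun z hz => ?_⟩
  · rw [Polynomial.mem_degreeLT] at hp hp' ⊢
    have hpm : p.degree ≤ m := Order.le_of_lt_succ hp
    calc (p * p').degree = p.degree + p'.degree := Polynomial.degree_mul
      _ ≤ m + p'.degree := by gcongr
      _ < m + n := WithBot.add_lt_add_left (WithBot.coe_ne_bot) hp'
      _ = ((m + n : ℕ) : WithBot ℕ) := by push_cast; rfl
  · have hpf' : z ^ m * f z = p.eval (z ^ 2) :=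
      mul_left_cancel₀ hz (by rw [← hpf z hz, pow_succ']; ring)
    rw [Pi.mul_apply, Polynomial.eval_mul, pow_add]
    linear_combination (z ^ n * g z) * hpf' + p.eval (z ^ 2) * hpg z hz

theorem trigPoly_le_add_two (n : ℕ) : trigPoly n ≤ trigPoly (n + 2) := by
  rintro f ⟨p, hp, hf⟩
  refine ⟨Polynomial.X * p, ?_, fun z hz => ?_⟩
  · rw [Polynomial.mem_degreeLT] at hp ⊢
    rw [Polynomial.X_mul, Polynomial.degree_mul_X]
    calc p.degree + 1 < n + 1 := WithBot.add_lt_add_right (WithBot.coe_ne_bot) hp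
      _ ≤ ((n + 2 : ℕ) : WithBot ℕ) := by exact_mod_cast Nat.le_succ (n + 1)
  · rw [Polynomial.eval_mul, Polynomial.eval_X]
    linear_combination z ^ 2 * hf z hz

theorem const_mem_trigPoly (c : ℂ) : (fun _ => c) ∈ trigPoly 1 :=
  ⟨Polynomial.C c, Polynomial.mem_degreeLT.2 (Polynomial.degree_C_le.trans_lt (by norm_num)),
    fun z _ => by simp⟩

theorem br_mem_trigPoly (c : ℂ) : (fun z => br (c * z)) ∈ trigPoly 2 := by
  refine ⟨Polynomial.C c * Polynomial.X + Polynomial.C (-c⁻¹),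
    Polynomial.mem_degreeLT.2 (Polynomial.degree_linear_le.trans_lt (by norm_num)),
    fun z hz => ?_⟩
  simp only [br, Polynomial.eval_add, Polynomial.eval_mul, Polynomial.eval_C, Polynomial.eval_X,
    mul_inv]
  field_simp
  ring

theorem prod_br_mem_trigPoly {ι : Type*} (s : Finset ι) (c : ι → ℂ) :
    (fun z => ∏ i ∈ s, br (c i * z)) ∈ trigPoly (s.card + 1) := by
  classical
  induction s using Finset.induction_on with
  | empty => simpa using const_mem_trigPoly 1
  | insert a s ha ih =>
    simp only [Finset.prod_insert ha, Finset.card_insert_of_notMem ha]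
    rw [add_comm (s.card + 1) 1]
    exact mul_mem_trigPoly (br_mem_trigPoly (c a)) ih

theorem trigPoly_apply_neg (hf : f ∈ trigPoly n) {z : ℂ} (hz : z ≠ 0) :
    f (-z) = (-1) ^ (n + 1) * f z := by
  obtain ⟨p, -, hpf⟩ := hf
  have hneg := hpf (-z) (neg_ne_zero.2 hz)
  rw [neg_sq, neg_mul, ← hpf z hz, neg_pow] at hneg
  have hsign : ((-1 : ℂ) ^ n) * (-1) ^ n = 1 := by rw [← mul_pow]; simp
  refine mul_left_cancel₀ (pow_ne_zero n hz) ?_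
  linear_combination (-1) ^ n * hneg - z ^ n * f (-z) * hsign

theorem eq_zero_of_mem_trigPoly_of_nodes (hf : f ∈ trigPoly n) {u : Fin n → ℂ}
    (hu0 : ∀ i, u i ≠ 0) (hu : Function.Injective fun i => u i ^ 2) (hfu : ∀ i, f (u i) = 0)
    {z : ℂ} (hz : z ≠ 0) : f z = 0 := by
  obtain ⟨p, hp, hpf⟩ := hf
  have hp0 : p = 0 := by
    refine Polynomial.eq_zero_of_degree_lt_of_eval_index_eq_zero (s := Finset.univ)
      (v := fun i => u i ^ 2) hu.injOn (by simpa using Polynomial.mem_degreeLT.1 hp) fun i _ => ?_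
    have h := hpf (u i) (hu0 i)
    rw [hfu i, mul_zero] at h
    exact (mul_eq_zero.1 h.symm).resolve_left (hu0 i)
  have h := hpf z hz
  rw [hp0, Polynomial.eval_zero, mul_zero] at h
  exact (mul_eq_zero.1 h).resolve_left (pow_ne_zero _ hz)

theorem trigPoly_mul_prod_br_of_nodes (hf : f ∈ trigPoly n) {u : Fin n → ℂ}
    (hu0 : ∀ i, u i ≠ 0) (hu : Function.Injective fun i => u i ^ 2) {j : Fin n}
    (hfu : ∀ i ≠ j, f (u i) = 0) {z : ℂ} (hz : z ≠ 0) :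
    f z * ∏ k ∈ Finset.univ.erase j, br (u j / u k) =
      f (u j) * ∏ k ∈ Finset.univ.erase j, br (z / u k) := by
  set p := ∏ k ∈ Finset.univ.erase j, br (u j / u k)
  set P : ℂ → ℂ := fun z => ∏ k ∈ Finset.univ.erase j, br (z / u k) with hP
  have hPmem : P ∈ trigPoly n := by
    have h := prod_br_mem_trigPoly (Finset.univ.erase j) fun k => (u k)⁻¹
    rw [Finset.card_erase_add_one (Finset.mem_univ _), Finset.card_univ, Fintype.card_fin] at h
    simpa only [hP, div_eq_inv_mul] using h
  have hPzero : ∀ i ≠ j, P (u i) = 0 := fun i hij =>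
    Finset.prod_eq_zero (Finset.mem_erase.2 ⟨hij, Finset.mem_univ i⟩)
      (by rw [div_self (hu0 i), br_one])
  suffices (p • f - f (u j) • P) z = 0 by
    simp only [Pi.sub_apply, Pi.smul_apply, smul_eq_mul] at this
    linear_combination this
  refine eq_zero_of_mem_trigPoly_of_nodes
    (sub_mem (Submodule.smul_mem _ _ hf) (Submodule.smul_mem _ _ hPmem)) hu0 hu (fun i => ?_) hz
  simp only [Pi.sub_apply, Pi.smul_apply, smul_eq_mul]
  by_cases hij : i = j
  · rw [hij]
    exact sub_eq_zero.2 (mul_comm _ _)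
  · rw [hfu i hij, hPzero i hij, mul_zero, mul_zero, sub_zero]

theorem finite_zeros_of_mem_trigPoly (hf : f ∈ trigPoly n) {z₀ : ℂ} (hz₀ : z₀ ≠ 0)
    (hfz₀ : f z₀ ≠ 0) : {z : ℂ | z ≠ 0 ∧ f z = 0}.Finite := by
  obtain ⟨p, -, hpf⟩ := hf
  have hp0 : p.comp (Polynomial.X ^ 2) ≠ 0 := fun h0 => by
    have hp := congrArg (Polynomial.eval z₀) h0
    simp only [Polynomial.eval_comp, Polynomial.eval_pow, Polynomial.eval_X,
      Polynomial.eval_zero] at hp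
    have h := hpf z₀ hz₀
    rw [hp, mul_zero] at h
    exact mul_ne_zero (pow_ne_zero _ hz₀) hfz₀ h
  refine (Polynomial.finite_setOfPred_isRoot hp0).subset ?_
  rintro z ⟨hz, hfz⟩
  have h := hpf z hz
  rw [hfz, mul_zero] at h
  simpa [Polynomial.eval_comp] using (mul_eq_zero.1 h.symm).resolve_left hz

theorem dotProduct_mulVec_mem_trigPoly {ι κ : Type*} [Fintype ι] [Fintype κ]
    {M : ℂ → Matrix ι κ ℂ} (hM : ∀ i k, (fun z => M z i k) ∈ trigPoly n)
    (x : ι → ℂ) (y : κ → ℂ) : (fun z => x ⬝ᵥ (M z *ᵥ y)) ∈ trigPoly n := by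
  have h : (∑ i, ∑ k, (x i * y k) • fun z => M z i k) ∈ trigPoly n :=
    Submodule.sum_mem _ fun i _ => Submodule.sum_mem _ fun k _ => Submodule.smul_mem _ _ (hM i k)
  convert h using 1
  funext z
  simp only [dotProduct, Matrix.mulVec, Finset.mul_sum, Finset.sum_apply, Pi.smul_apply,
    smul_eq_mul]
  exact Finset.sum_congr rfl fun i _ => Finset.sum_congr rfl fun k _ => by ring

end TrigPoly

/-! ### Biorthogonal families -/

/-- A family `L` of covectors and a family `K` of vectors that are orthogonal to each other, with
non-zero diagonal pairings (which are not normalised). -/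
structure Biorthogonal {𝕜 ι n : Type*} [Field 𝕜] [Fintype n] (L K : ι → n → 𝕜) : Prop where
  orthogonal : ∀ i j, i ≠ j → L i ⬝ᵥ K j = 0
  norm_ne_zero : ∀ i, L i ⬝ᵥ K i ≠ 0

namespace Biorthogonal

variable {𝕜 ι n : Type*} [Field 𝕜] [Fintype n] {L K : ι → n → 𝕜}

theorem symm (H : Biorthogonal L K) : Biorthogonal K L where
  orthogonal i j hij := by rw [dotProduct_comm, H.orthogonal j i hij.symm]
  norm_ne_zero i := by rw [dotProduct_comm]; exact H.norm_ne_zero i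

theorem sum_smul_dotProduct [Fintype ι] (H : Biorthogonal L K) (x : ι → 𝕜) (i : ι) :
    (∑ j, x j • L j) ⬝ᵥ K i = x i * (L i ⬝ᵥ K i) := by
  rw [sum_dotProduct, Finset.sum_eq_single i, smul_dotProduct, smul_eq_mul]
  · intro j _ hji
    rw [smul_dotProduct, H.orthogonal j i hji, smul_zero]
  · exact fun h => absurd (Finset.mem_univ i) h

theorem linearIndependent [Finite ι] (H : Biorthogonal L K) : LinearIndependent 𝕜 L := by
  cases nonempty_fintype ι
  rw [Fintype.linearIndependent_iff]
  intro x hx i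
  have h := H.sum_smul_dotProduct x i
  rw [hx, zero_dotProduct, eq_comm, mul_eq_zero] at h
  exact h.resolve_right (H.norm_ne_zero i)

theorem exists_dotProduct_eq [Finite ι] (H : Biorthogonal L K) (y : ι → 𝕜) :
    ∃ x : n → 𝕜, ∀ i, x ⬝ᵥ K i = y i := by
  cases nonempty_fintype ι
  refine ⟨∑ j, (y j / (L j ⬝ᵥ K j)) • L j, fun i => ?_⟩
  rw [H.sum_smul_dotProduct, div_mul_cancel₀ _ (H.norm_ne_zero i)]

variable [Fintype ι]

theorem span_eq_top (H : Biorthogonal L K) (hcard : Fintype.card ι = Fintype.card n) :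
    Submodule.span 𝕜 (Set.range L) = ⊤ :=
  H.linearIndependent.span_eq_top_of_card_eq_finrank' (by simp [hcard])

theorem eq_sum (H : Biorthogonal L K) (hcard : Fintype.card ι = Fintype.card n) (x : n → 𝕜) :
    x = ∑ i, (x ⬝ᵥ K i / (L i ⬝ᵥ K i)) • L i := by
  have hx : x ∈ Submodule.span 𝕜 (Set.range L) := H.span_eq_top hcard ▸ Submodule.mem_top
  obtain ⟨a, rfl⟩ := (Submodule.mem_span_range_iff_exists_fun 𝕜).1 hx
  simp only [H.sum_smul_dotProduct, mul_div_cancel_right₀ _ (H.norm_ne_zero _)]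

theorem eq_zero_of_dotProduct_eq_zero (H : Biorthogonal L K)
    (hcard : Fintype.card ι = Fintype.card n) {x : n → 𝕜} (hx : ∀ i, x ⬝ᵥ K i = 0) : x = 0 := by
  rw [H.eq_sum hcard x]
  simp [hx]

theorem dotProduct_eq_sum (H : Biorthogonal L K) (hcard : Fintype.card ι = Fintype.card n)
    (x y : n → 𝕜) :
    x ⬝ᵥ y = ∑ i, (x ⬝ᵥ K i) * (L i ⬝ᵥ y) / (L i ⬝ᵥ K i) := by
  conv_lhs => rw [H.eq_sum hcard x, sum_dotProduct]
  simp only [smul_dotProduct, smul_eq_mul, div_mul_eq_mul_div]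

end Biorthogonal

/-! ### Heights and their nodes -/

section Heights

variable {N : ℕ} {h g : Fin N → ℕ} {j k : Fin N}

theorem exists_eq_add_single (hh : h ≤ 2) (hj : 0 < h j) :
    ∃ g : Fin N → ℕ, g ≤ 2 ∧ g j ≤ 1 ∧ h = g + Pi.single j 1 := by
  have hle : Pi.single j 1 ≤ h := by
    intro i
    rcases eq_or_ne i j with rfl | hi
    · simpa using Nat.succ_le_of_lt hj
    · simp [hi]
  refine ⟨h - Pi.single j 1, tsub_le_self.trans hh, ?_, (tsub_add_cancel_of_le hle).symm⟩
  have := hh j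
  simp only [Pi.ofNat_apply, Pi.sub_apply, Pi.single_eq_same] at this ⊢
  omega

theorem add_single_le_two (hg : g ≤ 2) (hj : g j ≤ 1) : g + Pi.single j 1 ≤ 2 := by
  intro i
  rcases eq_or_ne i j with rfl | hi
  · simpa using Nat.succ_le_succ hj
  · simpa [hi] using hg i

theorem add_single_ne_of_ne (hkj : k ≠ j) : g + Pi.single k 1 ≠ g + Pi.single j 1 := fun h => by
  simpa [hkj] using congrFun h k

theorem heights_induction {P : (Fin N → ℕ) → Prop} (zero : P 0)
    (raise : ∀ g j, g ≤ 2 → g j ≤ 1 → P g → P (g + Pi.single j 1)) : ∀ h ≤ 2, P h := by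
  intro h
  induction h using WellFoundedLT.induction with
  | ind h ih =>
    intro hh
    by_cases h0 : h = 0
    · rwa [h0]
    · obtain ⟨j, hj⟩ := Function.ne_iff.1 h0
      obtain ⟨g, hg, hgj, rfl⟩ := exists_eq_add_single hh (Nat.pos_of_ne_zero hj)
      have hlt : g < g + Pi.single j 1 := lt_add_of_pos_right _ (Pi.single_pos.2 one_pos)
      exact raise g j hg hgj (ih g hlt hg)

/-- Heights with values in `{0, 1, 2}`, as natural numbers. -/
def natHeights (h : Fin N → Fin 3) : Fin N → ℕ := fun i => h i

theorem natHeights_le_two (h : Fin N → Fin 3) : natHeights h ≤ 2 := fun i =>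
  Nat.le_of_lt_succ (h i).isLt

theorem natHeights_injective : Function.Injective (natHeights (N := N)) := fun _ _ h =>
  funext fun i => Fin.ext (congrFun h i)

theorem exists_natHeights_eq (hh : h ≤ 2) : ∃ h', natHeights h' = h :=
  ⟨fun i => ⟨h i, Nat.lt_succ_of_le (hh i)⟩, rfl⟩

theorem eq_prod_mul_of_update {M : Type*} [CommMonoid M] {F : (Fin N → ℕ) → M}
    {f : Fin N → ℕ → M}
    (hF : ∀ h ≤ 2, ∀ j, F h = f j (h j) * F (Function.update h j 0)) (hh : h ≤ 2) :
    F h = (∏ i, f i (h i)) * F 0 := by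
  suffices ∀ S : Finset (Fin N), F h = (∏ i ∈ S, f i (h i)) * F (S.piecewise 0 h) by
    simpa using this Finset.univ
  intro S
  induction S using Finset.induction_on with
  | empty => simp
  | insert j S hj ih =>
    have hle : S.piecewise 0 h ≤ 2 := Finset.piecewise_le_of_le_of_le _ (fun _ => Nat.zero_le _) hh
    rw [ih, hF _ hle j, Finset.piecewise_eq_of_notMem _ _ _ hj, Finset.prod_insert hj,
      Finset.piecewise_insert, mul_left_comm, mul_assoc, Pi.zero_apply]

theorem exists_eq_raise_of_le_two (hh : h ≤ 2) (j : Fin N) :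
    ∃ g : Fin N → ℕ, g ≤ 2 ∧ g j = 0 ∧
      (h = g ∨ h = g + Pi.single j 1 ∨ h = g + Pi.single j 1 + Pi.single j 1) := by
  have hj : h j ≤ 2 := hh j
  obtain h0 | hpos := Nat.eq_zero_or_pos (h j)
  · exact ⟨h, hh, h0, .inl rfl⟩
  obtain ⟨f, hf, hfj, rfl⟩ := exists_eq_add_single hh hpos
  obtain h0 | hpos := Nat.eq_zero_or_pos (f j)
  · exact ⟨f, hf, h0, .inr (.inl rfl)⟩
  obtain ⟨g, hg, -, rfl⟩ := exists_eq_add_single hf hpos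
  exact ⟨g, hg, by simpa using hfj, .inr (.inr rfl)⟩

theorem prod_eq_mul_prod_update {M : Type*} [CommMonoid M] {f : Fin N → ℕ → M}
    (f_zero : ∀ i, f i 0 = 1) (h : Fin N → ℕ) (j : Fin N) :
    ∏ i, f i (h i) = f j (h j) * ∏ i, f i (Function.update h j 0 i) := by
  rw [← Finset.mul_prod_erase _ _ (Finset.mem_univ j),
    ← Finset.mul_prod_erase _ (fun i => f i (Function.update h j 0 i)) (Finset.mem_univ j),
    Function.update_self, f_zero, one_mul]
  exact congrArg _ (Finset.prod_congr rfl fun i hi => by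
    rw [Function.update_of_ne (Finset.ne_of_mem_erase hi)])

theorem update_add_single (hj : g j = 0) (m : ℕ) :
    Function.update (g + Pi.single j m) j 0 = g := by
  funext i
  rcases eq_or_ne i j with rfl | hi
  · simp [hj]
  · simp [hi]

theorem eq_prod_mul_iff {R : Type*} [CommRing R] [IsDomain R] {F : (Fin N → ℕ) → R}
    {f : Fin N → ℕ → R} {a b : Fin N → R} (f_zero : ∀ i, f i 0 = 1) (f_one : ∀ i, f i 1 = 0)
    (f_two : ∀ i, a i * f i 2 = b i) (ha : ∀ i, a i ≠ 0) :
    (∀ h ≤ 2, F h = (∏ i, f i (h i)) * F 0) ↔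
      ∀ g ≤ 2, ∀ j, g j = 0 → F (g + Pi.single j 1) = 0 ∧
        a j * F (g + Pi.single j 1 + Pi.single j 1) = b j * F g := by
  have two (g : Fin N → ℕ) (j : Fin N) :
      g + Pi.single j 1 + Pi.single j 1 = g + Pi.single j 2 := by
    rw [add_assoc, ← Pi.single_add]
  constructor
  · intro hF g hg j hj
    have h1 : g + Pi.single j 1 ≤ 2 := add_single_le_two hg (by omega)
    have h2 : g + Pi.single j 1 + Pi.single j 1 ≤ 2 := add_single_le_two h1 (by simp [hj])
    rw [hF _ h1, hF _ h2, hF g hg, two, prod_eq_mul_prod_update f_zero _ j,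
      prod_eq_mul_prod_update f_zero (g + Pi.single j 2) j, update_add_single hj,
      update_add_single hj, ← f_two]
    simp [hj, f_one, mul_assoc]
  · refine fun hrec h hh => eq_prod_mul_of_update (fun h hh j => ?_) hh
    obtain ⟨g, hg, hj, rfl | rfl | rfl⟩ := exists_eq_raise_of_le_two hh j
    · rw [hj, f_zero, one_mul, ← hj, Function.update_eq_self]
    · simp [hj, f_one, (hrec g hg j hj).1]
    · apply mul_left_cancel₀ (ha j)
      rw [(hrec g hg j hj).2, two, update_add_single hj, ← mul_assoc]
      simp [hj, f_two]

variable {q : ℂ} {w : Fin N → ℂ}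

/-- The point `q^(1-h_j) w_j`.  Evaluating `𝓑` and `𝓒` at these points raises and lowers the
height `h_j`. -/
noncomputable def node (q : ℂ) (w : Fin N → ℂ) (h : Fin N → ℕ) (j : Fin N) : ℂ :=
  q ^ (1 - (h j : ℤ)) * w j

theorem node_congr (hj : h j = g j) : node q w h j = node q w g j := by
  rw [node, node, hj]

theorem node_of_eq_zero (hj : h j = 0) : node q w h j = q * w j := by simp [node, hj]

theorem node_of_eq_one (hj : h j = 1) : node q w h j = w j := by simp [node, hj]

theorem node_add_single_of_ne (hkj : k ≠ j) :
    node q w (h + Pi.single j 1) k = node q w h k :=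
  node_congr (by simp [hkj])

theorem prod_br_div_node_add_single (z : ℂ) :
    ∏ k ∈ Finset.univ.erase j, br (z / node q w (h + Pi.single j 1) k) =
      ∏ k ∈ Finset.univ.erase j, br (z / node q w h k) :=
  Finset.prod_congr rfl fun _ hk => by rw [node_add_single_of_ne (Finset.ne_of_mem_erase hk)]

theorem node_add_single_self (hq : q ≠ 0) :
    node q w (h + Pi.single j 1) j = q⁻¹ * node q w h j := by
  rw [node, node, ← mul_assoc, ← zpow_neg_one, ← zpow_add₀ hq]
  congr 2
  simp only [Pi.add_apply, Pi.single_eq_same, Nat.cast_add, Nat.cast_one]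
  ring

theorem node_ne_zero (hq : q ≠ 0) (hw : ∀ i, w i ≠ 0) (h : Fin N → ℕ) (j : Fin N) :
    node q w h j ≠ 0 :=
  mul_ne_zero (zpow_ne_zero _ hq) (hw j)

theorem GenericInhom.br_zpow_mul_div_ne_zero (hq : q ≠ 0) (hw : GenericInhom q w)
    (hkj : k ≠ j) {m : ℤ} (hm : |m| ≤ 2) : br (q ^ m * w k / w j) ≠ 0 := by
  refine br_div_ne_zero (mul_ne_zero (zpow_ne_zero _ hq) (hw.1 k)) (hw.1 j) ?_
  rw [mul_pow, ← zpow_natCast, ← zpow_mul, mul_comm m]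
  exact fun h => hw.2 j k hkj.symm m hm h.symm

theorem GenericInhom.br_div_ne_zero (hq : q ≠ 0) (hw : GenericInhom q w) (hkj : k ≠ j) :
    br (w k / w j) ≠ 0 := by
  simpa using hw.br_zpow_mul_div_ne_zero hq hkj (m := 0) (by norm_num)

theorem GenericInhom.br_zpow_mul_div_ne_zero_of_dvd (hq : q ≠ 0) (hq4 : q ^ 4 ≠ 1)
    (hw : GenericInhom q w) {m : ℤ} (hm : m ∣ 2) (k j : Fin N) : br (q ^ m * w k / w j) ≠ 0 := by
  rcases eq_or_ne k j with rfl | hkj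
  · rw [mul_div_assoc, div_self (hw.1 k), mul_one]
    exact br_zpow_ne_zero hq hq4 hm
  · exact hw.br_zpow_mul_div_ne_zero hq hkj
      (Int.le_of_dvd two_pos ((abs_dvd m 2).2 hm))

theorem GenericInhom.br_mul_div_ne_zero (hq : q ≠ 0) (hq4 : q ^ 4 ≠ 1) (hw : GenericInhom q w)
    (k j : Fin N) : br (q * w k / w j) ≠ 0 := by
  simpa using hw.br_zpow_mul_div_ne_zero_of_dvd hq hq4 (one_dvd 2) k j

theorem GenericInhom.br_sq_mul_div_ne_zero (hq : q ≠ 0) (hq4 : q ^ 4 ≠ 1)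
    (hw : GenericInhom q w) (k j : Fin N) : br (q ^ 2 * w k / w j) ≠ 0 := by
  exact_mod_cast hw.br_zpow_mul_div_ne_zero_of_dvd hq hq4 (dvd_refl 2) k j

theorem GenericInhom.br_sq_inv_mul_div_ne_zero (hq : q ≠ 0) (hq4 : q ^ 4 ≠ 1)
    (hw : GenericInhom q w) (k j : Fin N) : br ((q ^ 2)⁻¹ * w k / w j) ≠ 0 := by
  rw [br_inv_mul_div]
  exact neg_ne_zero.2 (hw.br_sq_mul_div_ne_zero hq hq4 j k)

theorem GenericInhom.br_node_div_node_ne_zero (hq : q ≠ 0) (hw : GenericInhom q w) (hh : h ≤ 2)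
    (hkj : k ≠ j) : br (node q w h k / node q w h j) ≠ 0 := by
  have hm : |(h j : ℤ) - h k| ≤ 2 := by
    have := hh j
    have := hh k
    simp only [Pi.ofNat_apply] at *
    rw [abs_le]
    constructor <;> omega
  have hratio : node q w h k / node q w h j = q ^ ((h j : ℤ) - h k) * w k / w j := by
    rw [node, node, mul_div_mul_comm, ← zpow_sub₀ hq, mul_div_assoc]
    congr 2
    ring
  exact hratio ▸ hw.br_zpow_mul_div_ne_zero hq hkj hm

theorem GenericInhom.node_sq_injective (hq : q ≠ 0) (hw : GenericInhom q w) (hh : h ≤ 2) :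
    Function.Injective fun j => node q w h j ^ 2 := by
  intro k j hsq
  by_contra hkj
  have hk := node_ne_zero hq hw.1 h k
  have hj := node_ne_zero hq hw.1 h j
  refine hw.br_node_div_node_ne_zero hq hh hkj ((br_eq_zero_iff (div_ne_zero hk hj)).2 ?_)
  rw [div_pow, div_eq_one_iff_eq (pow_ne_zero _ hj)]
  exact hsq

end Heights

/-! ### Height systems -/

section HeightSystems

variable {N : ℕ} {n : Type*} [Fintype n] [DecidableEq n] {q : ℂ} {w : Fin N → ℂ}
  {A B C D : ℂ → Matrix n n ℂ} {c e : ℂ → ℂ} {K L : (Fin N → ℕ) → n → ℂ}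

/-- The part of the Yang–Baxter algebra that determines how `B`, `C` and `D` act on the height
states `K h`, which are created from a pseudo-vacuum `K 0` by `B`.  The quantum determinant is
written as `c v * e v`, where `c` normalises the action of `B`. -/
structure HeightSystem (q : ℂ) (w : Fin N → ℂ) (A B C D : ℂ → Matrix n n ℂ) (c e : ℂ → ℂ)
    (K : (Fin N → ℕ) → n → ℂ) : Prop where
  q_ne_zero : q ≠ 0
  q_pow_four_ne_one : q ^ 4 ≠ 1
  genericInhom : GenericInhom q w
  exchange_DB : ∀ u v, u ≠ 0 → v ≠ 0 →
    br (u / v) • (D u * B v) = br (q * u / v) • (B v * D u) - br q • (B u * D v)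
  exchange_CB : ∀ u v, u ≠ 0 → v ≠ 0 →
    br (u / v) • (C u * B v - B v * C u) = br q • (A v * D u - A u * D v)
  quantumDet : ∀ v, v ≠ 0 → A (q⁻¹ * v) * D v - C (q⁻¹ * v) * B v = (c v * e v) • 1
  D_vac : ∀ j, D (q * w j) *ᵥ K 0 = 0
  C_vac : ∀ u, u ≠ 0 → C u *ᵥ K 0 = 0
  B_node : ∀ h j, h j ≤ 1 → B (node q w h j) *ᵥ K h = c (node q w h j) • K (h + Pi.single j 1)
  c_node_ne_zero : ∀ h j, h j ≤ 1 → c (node q w h j) ≠ 0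

namespace HeightSystem

variable {h g : Fin N → ℕ} {j k : Fin N}

theorem node_ne_zero (S : HeightSystem q w A B C D c e K) (h : Fin N → ℕ) (j : Fin N) :
    node q w h j ≠ 0 :=
  TenVertex.node_ne_zero S.q_ne_zero S.genericInhom.1 h j

theorem K_add_single (S : HeightSystem q w A B C D c e K) (hj : h j ≤ 1) :
    K (h + Pi.single j 1) = (c (node q w h j))⁻¹ • (B (node q w h j) *ᵥ K h) := by
  rw [S.B_node h j hj, smul_smul, inv_mul_cancel₀ (S.c_node_ne_zero h j hj), one_smul]

theorem D_node (S : HeightSystem q w A B C D c e K) :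
    ∀ h ≤ 2, ∀ k, D (node q w h k) *ᵥ K h = 0 := by
  refine heights_induction (fun k => by simpa [node] using S.D_vac k) fun g j hg hj ih k => ?_
  have hv := S.node_ne_zero g j
  have commute_past_B : ∀ u, u ≠ 0 → br (u / node q w g j) ≠ 0 →
      br (q * u / node q w g j) • (D u *ᵥ K g) = 0 → D u *ᵥ K (g + Pi.single j 1) = 0 := by
    intro u hu hbr hDu
    have hDB := congrArg (· *ᵥ K g) (S.exchange_DB u _ hu hv)
    simp only [Matrix.smul_mulVec, Matrix.sub_mulVec, ← Matrix.mulVec_mulVec, ih j,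
      Matrix.mulVec_zero, smul_zero, sub_zero] at hDB
    rw [← Matrix.mulVec_smul (B _), hDu, Matrix.mulVec_zero] at hDB
    rw [S.K_add_single hj, Matrix.mulVec_smul, (smul_eq_zero.1 hDB).resolve_left hbr, smul_zero]
  rcases eq_or_ne k j with rfl | hkj
  · rw [node_add_single_self S.q_ne_zero]
    refine commute_past_B _ (mul_ne_zero (inv_ne_zero S.q_ne_zero) hv) ?_ ?_
    · rw [mul_div_assoc, div_self hv, mul_one, br_inv]
      exact neg_ne_zero.2 (by
        simpa using br_zpow_ne_zero S.q_ne_zero S.q_pow_four_ne_one (one_dvd 2))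
    · rw [mul_inv_cancel_left₀ S.q_ne_zero, div_self hv, br_one, zero_smul]
  · rw [node_add_single_of_ne hkj]
    refine commute_past_B _ (S.node_ne_zero g k)
      (S.genericInhom.br_node_div_node_ne_zero S.q_ne_zero hg hkj) ?_
    rw [ih k, smul_zero]

theorem C_node_of_eq_zero (S : HeightSystem q w A B C D c e K) :
    ∀ h ≤ 2, ∀ k, h k = 0 → C (node q w h k) *ᵥ K h = 0 := by
  refine heights_induction (fun k _ => S.C_vac _ (S.node_ne_zero _ _))
    fun g j hg hj ih k hk => ?_
  have hkj : k ≠ j := by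
    rintro rfl
    simp at hk
  rw [node_add_single_of_ne hkj]
  have hgk : g k = 0 := by simpa [hkj] using hk
  have hCB := congrArg (· *ᵥ K g) (S.exchange_CB _ _ (S.node_ne_zero g k) (S.node_ne_zero g j))
  simp only [Matrix.smul_mulVec, Matrix.sub_mulVec, ← Matrix.mulVec_mulVec, ih k hgk,
    S.D_node g hg, Matrix.mulVec_zero, smul_zero, sub_zero] at hCB
  rw [S.K_add_single hj, Matrix.mulVec_smul, (smul_eq_zero.1 hCB).resolve_left
    (S.genericInhom.br_node_div_node_ne_zero S.q_ne_zero hg hkj), smul_zero]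

theorem C_node_add_single (S : HeightSystem q w A B C D c e K) (hg : g ≤ 2) (hj : g j ≤ 1) :
    C (node q w (g + Pi.single j 1) j) *ᵥ K (g + Pi.single j 1) =
      -e (node q w g j) • K g := by
  have hdet := congrArg (· *ᵥ K g) (S.quantumDet _ (S.node_ne_zero g j))
  simp only [Matrix.smul_mulVec, Matrix.sub_mulVec, ← Matrix.mulVec_mulVec, Matrix.one_mulVec,
    S.D_node g hg, Matrix.mulVec_zero, zero_sub] at hdet
  rw [S.K_add_single hj, Matrix.mulVec_smul, node_add_single_self S.q_ne_zero,
    neg_eq_iff_eq_neg.1 hdet, ← smul_neg, mul_smul, inv_smul_smul₀ (S.c_node_ne_zero g j hj),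
    neg_smul, smul_neg]

end HeightSystem

/-- Two height systems, for vectors and for covectors, that are exchanged by transposition. -/
structure HeightPair (q : ℂ) (w : Fin N → ℂ) (A B C D : ℂ → Matrix n n ℂ) (c e : ℂ → ℂ)
    (K L : (Fin N → ℕ) → n → ℂ) : Prop where
  ket : HeightSystem q w A B C D c e K
  bra : HeightSystem q w (fun z => (A z)ᵀ) (fun z => (C z)ᵀ) (fun z => (B z)ᵀ) (fun z => (D z)ᵀ)
    e c L
  trig_B : ∀ σ τ, (fun z => B z σ τ) ∈ trigPoly N
  trig_C : ∀ σ τ, (fun z => C z σ τ) ∈ trigPoly N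
  vac : L 0 ⬝ᵥ K 0 = 1

namespace HeightPair

variable {h g : Fin N → ℕ} {j k : Fin N}

theorem dual (S : HeightPair q w A B C D c e K L) :
    HeightPair q w (fun z => (A z)ᵀ) (fun z => (C z)ᵀ) (fun z => (B z)ᵀ) (fun z => (D z)ᵀ)
      e c L K where
  ket := S.bra
  bra := by simpa only [Matrix.transpose_transpose] using S.ket
  trig_B := fun σ τ => S.trig_C τ σ
  trig_C := fun σ τ => S.trig_B τ σ
  vac := by rw [dotProduct_comm]; exact S.vac

theorem mul_L_add_single_dotProduct (S : HeightPair q w A B C D c e K L) (hj : g j ≤ 1)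
    (x : n → ℂ) :
    e (node q w g j) * (L (g + Pi.single j 1) ⬝ᵥ x) = L g ⬝ᵥ (C (node q w g j) *ᵥ x) := by
  rw [← smul_eq_mul, ← smul_dotProduct, ← S.bra.B_node g j hj, Matrix.mulVec_transpose,
    Matrix.dotProduct_mulVec]

theorem dotProduct_C_node_eq_zero (S : HeightPair q w A B C D c e K L)
    (orth : ∀ h ≤ 2, h ≠ g → L g ⬝ᵥ K h = 0) (hh : h ≤ 2) (hne : h ≠ g + Pi.single k 1) :
    L g ⬝ᵥ (C (node q w h k) *ᵥ K h) = 0 := by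
  rcases Nat.eq_zero_or_pos (h k) with h0 | hpos
  · rw [S.ket.C_node_of_eq_zero h hh k h0, dotProduct_zero]
  · obtain ⟨f, hf, hfk, rfl⟩ := exists_eq_add_single hh hpos
    rw [S.ket.C_node_add_single hf hfk, dotProduct_smul,
      orth f hf (by rintro rfl; exact hne rfl), smul_zero]

-- The pairing is a trigonometric polynomial in the argument of `C`, so it can be moved from the
-- nodes of `h` to a node of `g`.
theorem dotProduct_C_node_eq_zero' (S : HeightPair q w A B C D c e K L)
    (orth : ∀ h ≤ 2, h ≠ g → L g ⬝ᵥ K h = 0) (hh : h ≤ 2) (hne : h ≠ g + Pi.single j 1) :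
    L g ⬝ᵥ (C (node q w g j) *ᵥ K h) = 0 := by
  by_cases hk : ∃ k, h = g + Pi.single k 1
  · obtain ⟨k, rfl⟩ := hk
    have hjk : j ≠ k := by rintro rfl; exact hne rfl
    rw [← node_add_single_of_ne hjk]
    exact S.dotProduct_C_node_eq_zero orth hh hne
  · push Not at hk
    exact eq_zero_of_mem_trigPoly_of_nodes (dotProduct_mulVec_mem_trigPoly S.trig_C (L g) (K h))
      (S.ket.node_ne_zero h) (S.ket.genericInhom.node_sq_injective S.ket.q_ne_zero hh)
      (fun k => S.dotProduct_C_node_eq_zero orth hh (hk k)) (S.ket.node_ne_zero g j)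

theorem orthogonal (S : HeightPair q w A B C D c e K L) :
    ∀ g ≤ 2, ∀ h ≤ 2, h ≠ g → L g ⬝ᵥ K h = 0 := by
  refine heights_induction (fun h hh h0 => ?_) fun g j _ hj ih h hh hne => ?_
  · obtain ⟨j, hj⟩ := Function.ne_iff.1 h0
    obtain ⟨f, -, hfj, rfl⟩ := exists_eq_add_single hh (Nat.pos_of_ne_zero hj)
    rw [S.ket.K_add_single hfj, dotProduct_smul, Matrix.dotProduct_mulVec,
      ← Matrix.mulVec_transpose, S.bra.C_vac _ (S.ket.node_ne_zero f j), zero_dotProduct,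
      smul_zero]
  · have hmul := S.mul_L_add_single_dotProduct hj (K h)
    rw [S.dotProduct_C_node_eq_zero' ih hh hne] at hmul
    exact (mul_eq_zero.1 hmul).resolve_left (S.bra.c_node_ne_zero g j hj)

theorem norm_add_single (S : HeightPair q w A B C D c e K L) (hg : g ≤ 2) (hj : g j ≤ 1) :
    (L (g + Pi.single j 1) ⬝ᵥ K (g + Pi.single j 1)) *
        ∏ k ∈ Finset.univ.erase j, br (q⁻¹ * node q w g j / node q w g k) =
      -(L g ⬝ᵥ K g) * ∏ k ∈ Finset.univ.erase j, br (node q w g j / node q w g k) := by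
  have hh := add_single_le_two hg hj
  have interpolation := trigPoly_mul_prod_br_of_nodes
    (dotProduct_mulVec_mem_trigPoly S.trig_C (L g) (K (g + Pi.single j 1)))
    (S.ket.node_ne_zero _) (S.ket.genericInhom.node_sq_injective S.ket.q_ne_zero hh) (j := j)
    (fun k hkj => S.dotProduct_C_node_eq_zero (S.orthogonal g hg) hh
      (add_single_ne_of_ne hkj.symm)) (S.ket.node_ne_zero g j)
  rw [← S.mul_L_add_single_dotProduct hj, S.ket.C_node_add_single hg hj, dotProduct_smul,
    smul_eq_mul, node_add_single_self S.ket.q_ne_zero] at interpolation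
  rw [prod_br_div_node_add_single, prod_br_div_node_add_single] at interpolation
  apply mul_left_cancel₀ (S.bra.c_node_ne_zero g j hj)
  linear_combination interpolation

theorem norm_ne_zero (S : HeightPair q w A B C D c e K L) : ∀ h ≤ 2, L h ⬝ᵥ K h ≠ 0 := by
  refine heights_induction (by rw [S.vac]; exact one_ne_zero) fun g j hg hj ih h0 => ?_
  have hnorm := S.norm_add_single hg hj
  rw [h0, zero_mul] at hnorm
  refine mul_ne_zero (neg_ne_zero.2 ih) (Finset.prod_ne_zero_iff.2 fun k hk => ?_) hnorm.symm
  exact S.ket.genericInhom.br_node_div_node_ne_zero S.ket.q_ne_zero hg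
    (Finset.ne_of_mem_erase hk).symm

theorem biorthogonal (S : HeightPair q w A B C D c e K L) :
    Biorthogonal (fun h : Fin N → Fin 3 => L (natHeights h)) fun h => K (natHeights h) where
  orthogonal g h hgh := S.orthogonal _ (natHeights_le_two g) _ (natHeights_le_two h)
    (natHeights_injective.ne hgh.symm)
  norm_ne_zero h := S.norm_ne_zero _ (natHeights_le_two h)

theorem eq_zero_of_dotProduct_K (S : HeightPair q w A B C D c e K L)
    (hn : Fintype.card (Fin N → Fin 3) = Fintype.card n) {x : n → ℂ}
    (hx : ∀ h ≤ 2, x ⬝ᵥ K h = 0) : x = 0 :=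
  S.biorthogonal.eq_zero_of_dotProduct_eq_zero hn fun h => hx _ (natHeights_le_two h)

theorem B_node_of_eq_two (S : HeightPair q w A B C D c e K L)
    (hn : Fintype.card (Fin N → Fin 3) = Fintype.card n) (hh : h ≤ 2) (hj : h j = 2) :
    B (node q w h j) *ᵥ K h = 0 := by
  refine S.dual.eq_zero_of_dotProduct_K hn fun g hg => ?_
  have hne : g ≠ h + Pi.single j 1 := by
    rintro rfl
    have := hg j
    simp [hj] at this
  rw [dotProduct_comm, Matrix.dotProduct_mulVec, ← Matrix.mulVec_transpose, dotProduct_comm]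
  exact S.dual.dotProduct_C_node_eq_zero' (S.dual.orthogonal h hh) hg hne

/-! ### The common kernel of `B + C` -/

theorem add_mulVec_of_eq_zero (S : HeightPair q w A B C D c e K L) (hg : g ≤ 2) (hj : g j = 0) :
    (B (q * w j) + C (q * w j)) *ᵥ K g = c (q * w j) • K (g + Pi.single j 1) := by
  rw [← node_of_eq_zero hj, Matrix.add_mulVec, S.ket.C_node_of_eq_zero g hg j hj, add_zero,
    S.ket.B_node g j (by omega)]

theorem add_mulVec_of_eq_one (S : HeightPair q w A B C D c e K L) (hg : g ≤ 2) (hj : g j = 0) :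
    (B (w j) + C (w j)) *ᵥ K (g + Pi.single j 1) =
      c (w j) • K (g + Pi.single j 1 + Pi.single j 1) - e (q * w j) • K g := by
  have h1 : (g + Pi.single j 1 : Fin N → ℕ) j = 1 := by simp [hj]
  rw [← node_of_eq_zero hj, ← node_of_eq_one (q := q) (w := w) h1, Matrix.add_mulVec,
    S.ket.C_node_add_single hg (by omega), S.ket.B_node _ j h1.le, neg_smul, sub_eq_add_neg]

theorem add_mulVec_of_eq_two (S : HeightPair q w A B C D c e K L)
    (hn : Fintype.card (Fin N → Fin 3) = Fintype.card n) (hg : g ≤ 2) (hj : g j = 0) :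
    (B (q⁻¹ * w j) + C (q⁻¹ * w j)) *ᵥ K (g + Pi.single j 1 + Pi.single j 1) =
      -e (w j) • K (g + Pi.single j 1) := by
  have h1 : (g + Pi.single j 1 : Fin N → ℕ) j = 1 := by simp [hj]
  have hle := add_single_le_two hg (j := j) (by omega)
  rw [← node_of_eq_one (q := q) (w := w) h1, ← node_add_single_self S.ket.q_ne_zero,
    Matrix.add_mulVec, S.ket.C_node_add_single hle h1.le,
    S.B_node_of_eq_two hn (add_single_le_two hle h1.le) (by simp [hj]), zero_add]

theorem forall_vecMul_eq_zero_iff (S : HeightPair q w A B C D c e K L)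
    (hn : Fintype.card (Fin N → Fin 3) = Fintype.card n) (φ : n → ℂ) :
    (∀ z, z ≠ 0 → φ ᵥ* (B z + C z) = 0) ↔
      ∀ g ≤ 2, ∀ j, g j = 0 → φ ⬝ᵥ K (g + Pi.single j 1) = 0 ∧
        c (w j) * φ ⬝ᵥ K (g + Pi.single j 1 + Pi.single j 1) = e (q * w j) * φ ⬝ᵥ K g := by
  have hq := S.ket.q_ne_zero
  have hw := S.ket.genericInhom.1
  constructor
  · intro hφ g hg j hj
    have at_zero := congrArg (φ ⬝ᵥ ·) (S.add_mulVec_of_eq_zero hg hj)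
    have at_one := congrArg (φ ⬝ᵥ ·) (S.add_mulVec_of_eq_one hg hj)
    simp only [Matrix.dotProduct_mulVec, hφ _ (mul_ne_zero hq (hw j)), hφ _ (hw j),
      zero_dotProduct, dotProduct_sub, dotProduct_smul, smul_eq_mul] at at_zero at_one
    have hc : c (q * w j) ≠ 0 := node_of_eq_zero hj ▸ S.ket.c_node_ne_zero g j (by omega)
    exact ⟨(mul_eq_zero.1 at_zero.symm).resolve_left hc, sub_eq_zero.1 at_one.symm⟩
  · intro hrec z hz
    refine S.eq_zero_of_dotProduct_K hn fun h hh => ?_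
    rw [← Matrix.dotProduct_mulVec]
    refine eq_zero_of_mem_trigPoly_of_nodes
      (dotProduct_mulVec_mem_trigPoly (M := fun z => B z + C z)
        (fun σ τ => add_mem (S.trig_B σ τ) (S.trig_C σ τ)) φ (K h))
      (S.ket.node_ne_zero h) (S.ket.genericInhom.node_sq_injective hq hh) (fun j => ?_) hz
    obtain ⟨g, hg, hj, rfl | rfl | rfl⟩ := exists_eq_raise_of_le_two hh j
    · rw [node_of_eq_zero hj, S.add_mulVec_of_eq_zero hg hj, dotProduct_smul, (hrec _ hg j hj).1,
        smul_zero]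
    · rw [node_of_eq_one (by simp [hj]), S.add_mulVec_of_eq_one hg hj, dotProduct_sub,
        dotProduct_smul, dotProduct_smul, smul_eq_mul, smul_eq_mul, (hrec g hg j hj).2, sub_self]
    · rw [node_add_single_self hq, node_of_eq_one (h := g + Pi.single j 1) (by simp [hj]),
        S.add_mulVec_of_eq_two hn hg hj, dotProduct_smul, (hrec g hg j hj).1, smul_zero]

theorem exists_leftKernel (S : HeightPair q w A B C D c e K L)
    (hn : Fintype.card (Fin N → Fin 3) = Fintype.card n) {f : Fin N → ℕ → ℂ}
    (f_zero : ∀ i, f i 0 = 1) (f_one : ∀ i, f i 1 = 0)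
    (f_two : ∀ i, c (w i) * f i 2 = e (q * w i)) :
    ∃ ψ : n → ℂ, ψ ≠ 0 ∧
      (∀ φ : n → ℂ, (∀ z, z ≠ 0 → φ ᵥ* (B z + C z) = 0) ↔ ∃ a : ℂ, φ = a • ψ) ∧
      ∀ h ≤ 2, ψ ⬝ᵥ K h = ∏ i, f i (h i) := by
  have hc : ∀ i, c (w i) ≠ 0 := fun i => by
    simpa [node] using S.ket.c_node_ne_zero 1 i le_rfl
  obtain ⟨ψ, hψ⟩ : ∃ ψ : n → ℂ, ∀ h ≤ 2, ψ ⬝ᵥ K h = ∏ i, f i (h i) := by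
    obtain ⟨ψ, hψ⟩ := S.biorthogonal.exists_dotProduct_eq fun h => ∏ i, f i (h i)
    refine ⟨ψ, fun h hh => ?_⟩
    obtain ⟨h, rfl⟩ := exists_natHeights_eq hh
    exact hψ h
  have hψ0 : ψ ⬝ᵥ K 0 = 1 := by
    rw [hψ 0 (fun _ => Nat.zero_le _)]
    exact Finset.prod_eq_one fun i _ => f_zero i
  refine ⟨ψ, fun h0 => by simp [h0] at hψ0, fun φ => ?_, hψ⟩
  rw [S.forall_vecMul_eq_zero_iff hn φ,
    ← eq_prod_mul_iff (F := fun h => φ ⬝ᵥ K h) f_zero f_one f_two hc]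
  constructor
  · refine fun hφ => ⟨φ ⬝ᵥ K 0, sub_eq_zero.1 (S.eq_zero_of_dotProduct_K hn fun h hh => ?_)⟩
    rw [sub_dotProduct, smul_dotProduct, hψ h hh, hφ h hh, smul_eq_mul, mul_comm, sub_self]
  · rintro ⟨a, rfl⟩ h hh
    simp only [smul_dotProduct, hψ h hh, hψ0, smul_eq_mul, mul_one, mul_comm]

end HeightPair

end HeightSystems

/-! ### The Yang–Baxter algebra -/

/-- The six-vertex `R`-matrix with weights `[qx]`, `[x]`, `[q]`, which intertwines two monodromy
matrices whose spectral parameters have the ratio `x`. -/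
noncomputable def sixVertex (q x : ℂ) : Matrix (Fin 2 × Fin 2) (Fin 2 × Fin 2) ℂ :=
  Matrix.of fun p r =>
    if p = r then (if p.1 = p.2 then br (q * x) else br x)
    else if p = r.swap then br q else 0

section Ring

variable {𝓐 : Type*} [Ring 𝓐] {M M' P P' : Matrix (Fin 2) (Fin 2) 𝓐}

/-- The product `M₁ M'₂` of two operator-valued matrices on different auxiliary spaces. -/
def mulLeftRight (M M' : Matrix (Fin 2) (Fin 2) 𝓐) : Matrix (Fin 2 × Fin 2) (Fin 2 × Fin 2) 𝓐 :=
  Matrix.of fun p r => M p.1 r.1 * M' p.2 r.2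

/-- The product `M'₂ M₁` of two operator-valued matrices on different auxiliary spaces. -/
def mulRightLeft (M M' : Matrix (Fin 2) (Fin 2) 𝓐) : Matrix (Fin 2 × Fin 2) (Fin 2 × Fin 2) 𝓐 :=
  Matrix.of fun p r => M' p.2 r.2 * M p.1 r.1

theorem mul_mul_mul_apply_of_commute (h : ∀ a b c d, Commute (P a b) (M' c d))
    (a b c d : Fin 2) :
    (M * P) a b * (M' * P') c d = ∑ i, ∑ j, (M a i * M' c j) * (P i b * P' j d) := by
  simp only [Matrix.mul_apply, Finset.sum_mul_sum]
  exact Finset.sum_congr rfl fun i _ => Finset.sum_congr rfl fun j _ =>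
    (h _ _ _ _).mul_mul_mul_comm _ _

theorem mulLeftRight_mul (h : ∀ a b c d, Commute (P a b) (M' c d)) :
    mulLeftRight (M * P) (M' * P') = mulLeftRight M M' * mulLeftRight P P' := by
  ext p r
  rw [Matrix.mul_apply, Fintype.sum_prod_type]
  exact mul_mul_mul_apply_of_commute h _ _ _ _

theorem mulRightLeft_mul (h : ∀ a b c d, Commute (P' a b) (M c d)) :
    mulRightLeft (M * P) (M' * P') = mulRightLeft M M' * mulRightLeft P P' := by
  ext p r
  rw [Matrix.mul_apply, Fintype.sum_prod_type, Finset.sum_comm]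
  exact mul_mul_mul_apply_of_commute h _ _ _ _

theorem mulLeftRight_one : mulLeftRight (1 : Matrix (Fin 2) (Fin 2) 𝓐) 1 = 1 := by
  ext p r
  simp [mulLeftRight, Matrix.one_apply, Prod.ext_iff, and_comm (a := p.1 = _), ite_and]

theorem mulRightLeft_one : mulRightLeft (1 : Matrix (Fin 2) (Fin 2) 𝓐) 1 = 1 := by
  ext p r
  simp [mulRightLeft, Matrix.one_apply, Prod.ext_iff, ite_and]

end Ring

section Exchange

variable {𝓐 𝓑 : Type*} [Ring 𝓐] [Algebra ℂ 𝓐] [Ring 𝓑] [Algebra ℂ 𝓑] {q x : ℂ}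
  {M M' P P' : Matrix (Fin 2) (Fin 2) 𝓐}

/-- The exchange relation `R₁₂(x) M₁ M'₂ = M'₂ M₁ R₁₂(x)` with the six-vertex `R`-matrix. -/
def Exchange (q x : ℂ) (M M' : Matrix (Fin 2) (Fin 2) 𝓐) : Prop :=
  ∀ p r, ∑ t, sixVertex q x p t • mulLeftRight M M' t r =
    ∑ t, sixVertex q x t r • mulRightLeft M M' p t

theorem sum_sixVertex_row_smul (p : Fin 2 × Fin 2) (X : Fin 2 × Fin 2 → 𝓐) :
    ∑ t, sixVertex q x p t • X t =
      if p.1 = p.2 then br (q * x) • X p else br x • X p + br q • X p.swap := by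
  fin_cases p <;> simp [sixVertex, Fintype.sum_prod_type, add_comm]

theorem sum_sixVertex_col_smul (r : Fin 2 × Fin 2) (X : Fin 2 × Fin 2 → 𝓐) :
    ∑ t, sixVertex q x t r • X t =
      if r.1 = r.2 then br (q * x) • X r else br x • X r + br q • X r.swap := by
  fin_cases r <;> simp [sixVertex, Fintype.sum_prod_type, add_comm]

theorem exchange_iff_entry : Exchange q x M M' ↔ ∀ a b c d,
    (if a = b then br (q * x) • (M a c * M' b d)
      else br x • (M a c * M' b d) + br q • (M b c * M' a d)) =
    if c = d then br (q * x) • (M' b d * M a c)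
      else br x • (M' b d * M a c) + br q • (M' b c * M a d) := by
  simp only [Exchange, sum_sixVertex_row_smul, sum_sixVertex_col_smul, mulLeftRight, mulRightLeft,
    Prod.forall, Matrix.of_apply, Prod.fst_swap, Prod.snd_swap]

theorem exchange_iff_mul_eq : Exchange q x M M' ↔
    (sixVertex q x).map (algebraMap ℂ 𝓐) * mulLeftRight M M' =
      mulRightLeft M M' * (sixVertex q x).map (algebraMap ℂ 𝓐) := by
  simp only [Exchange, ← Matrix.ext_iff, Matrix.mul_apply, Matrix.map_apply,
    ← Algebra.commutes, ← Algebra.smul_def]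

theorem Exchange.mul (hM : Exchange q x M M')
    (hP : Exchange q x P P') (h : ∀ a b c d, Commute (P a b) (M' c d))
    (h' : ∀ a b c d, Commute (P' a b) (M c d)) : Exchange q x (M * P) (M' * P') := by
  rw [exchange_iff_mul_eq] at *
  rw [mulLeftRight_mul h, mulRightLeft_mul h', ← mul_assoc, hM, mul_assoc, hP, mul_assoc]

theorem Exchange.one (q x : ℂ) : Exchange q x (1 : Matrix (Fin 2) (Fin 2) 𝓐) 1 := by
  rw [exchange_iff_mul_eq, mulLeftRight_one, mulRightLeft_one, mul_one, one_mul]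

theorem Exchange.map (φ : 𝓐 →ₐ[ℂ] 𝓑) (h : Exchange q x M M') :
    Exchange q x (M.map φ) (M'.map φ) := fun p r => by
  simpa only [map_sum, map_smul, mulLeftRight, mulRightLeft, Matrix.of_apply, Matrix.map_apply,
    map_mul] using congrArg φ (h p r)

theorem Exchange.BB (h : Exchange q x M M') :
    br (q * x) • (M 0 1 * M' 0 1) = br (q * x) • (M' 0 1 * M 0 1) := by
  simpa using exchange_iff_entry.1 h 0 0 1 1

theorem Exchange.DB (h : Exchange q x M M') :
    br x • (M 1 1 * M' 0 1) = br (q * x) • (M' 0 1 * M 1 1) - br q • (M 0 1 * M' 1 1) := by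
  have key : br x • (M 1 1 * M' 0 1) + br q • (M 0 1 * M' 1 1) =
      br (q * x) • (M' 0 1 * M 1 1) := by
    simpa using exchange_iff_entry.1 h 1 0 1 1
  exact eq_sub_of_add_eq key

theorem Exchange.CB (h : Exchange q x M M') :
    br x • (M 1 0 * M' 0 1 - M' 0 1 * M 1 0) = br q • (M' 0 0 * M 1 1 - M 0 0 * M' 1 1) := by
  have key : br x • (M 1 0 * M' 0 1) + br q • (M 0 0 * M' 1 1) =
      br x • (M' 0 1 * M 1 0) + br q • (M' 0 0 * M 1 1) := by
    simpa using exchange_iff_entry.1 h 1 0 0 1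
  linear_combination (norm := module) key

/-- The quantum determinant of the pair `M`, `M'` is the scalar `δ`: contracting the columns of
`M₁ M'₂` with the antisymmetric tensor gives `δ` times that tensor. -/
def QuantumDet (δ : ℂ) (M M' : Matrix (Fin 2) (Fin 2) 𝓐) : Prop :=
  ∀ a b, M 0 a * M' 1 b - M 1 a * M' 0 b =
    (δ * (!![0, 1; -1, 0] : Matrix (Fin 2) (Fin 2) ℂ) a b) • (1 : 𝓐)

theorem QuantumDet.one : QuantumDet 1 (1 : Matrix (Fin 2) (Fin 2) 𝓐) 1 := by
  intro a b
  fin_cases a <;> fin_cases b <;> simp [Matrix.one_apply]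

theorem QuantumDet.mul {δ ε : ℂ} (hM : QuantumDet δ M M')
    (hP : QuantumDet ε P P') (h : ∀ a b c d, Commute (P a b) (M' c d)) :
    QuantumDet (δ * ε) (M * P) (M' * P') := by
  intro a b
  calc (M * P) 0 a * (M' * P') 1 b - (M * P) 1 a * (M' * P') 0 b
      = ∑ i, ∑ j, (M 0 i * M' 1 j - M 1 i * M' 0 j) * (P i a * P' j b) := by
        simp only [mul_mul_mul_apply_of_commute h, sub_mul, Finset.sum_sub_distrib]
    _ = δ • (P 0 a * P' 1 b - P 1 a * P' 0 b) := by
        simp [hM _ _, Fin.sum_univ_two, sub_eq_add_neg]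
    _ = _ := by rw [hP a b, smul_smul, mul_assoc]

theorem QuantumDet.map (φ : 𝓐 →ₐ[ℂ] 𝓑) {δ : ℂ} (h : QuantumDet δ M M') :
    QuantumDet δ (M.map φ) (M'.map φ) := fun a b => by
  simpa only [Matrix.map_apply, map_sub, map_mul, map_smul, map_one] using congrArg φ (h a b)

/-- The relations of `U_q(sl₂)`, with `k⁻¹` as a separate variable `kinv` and the generators scaled
so that `e f - f e = [q] (k² - k⁻²)`. -/
structure IsQuantumSl2 (q : ℂ) (k kinv e f : 𝓐) : Prop where
  k_mul_kinv : k * kinv = 1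
  kinv_mul_k : kinv * k = 1
  k_mul_e : k * e = q • (e * k)
  kinv_mul_e : kinv * e = q⁻¹ • (e * kinv)
  k_mul_f : k * f = q⁻¹ • (f * k)
  kinv_mul_f : kinv * f = q • (f * kinv)
  e_mul_f : e * f = f * e + br q • (k * k - kinv * kinv)

/-- The `L`-operator of `U_q(sl₂)`. -/
noncomputable def lOperator (k kinv e f : 𝓐) (x : ℂ) : Matrix (Fin 2) (Fin 2) 𝓐 :=
  !![x • k - x⁻¹ • kinv, f; e, x • kinv - x⁻¹ • k]

section LOperator

variable {k kinv e f : 𝓐} {x y : ℂ}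

theorem IsQuantumSl2.exchange (h : IsQuantumSl2 q k kinv e f) (hq : q ≠ 0) (hx : x ≠ 0)
    (hy : y ≠ 0) :
    Exchange q (x / y) (lOperator k kinv e f x) (lOperator k kinv e f y) := by
  rw [exchange_iff_entry]
  simp only [Fin.forall_fin_two, lOperator, Matrix.of_apply, Matrix.cons_val', Matrix.cons_val_zero,
    Matrix.cons_val_one, Matrix.cons_val_fin_one, mul_sub, sub_mul,
    smul_mul_assoc, mul_smul_comm, h.k_mul_kinv, h.kinv_mul_k, h.k_mul_e, h.kinv_mul_e, h.k_mul_f,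
    h.kinv_mul_f, h.e_mul_f, br, if_true, if_false, zero_ne_one, one_ne_zero,
    and_true, true_and]
  and_intros <;> match_scalars <;> field_simp <;> ring

theorem IsQuantumSl2.quantumDet (h : IsQuantumSl2 q k kinv e f) (hq : q ≠ 0) (hx : x ≠ 0) {κ : ℂ}
    (hκ : f * e + q • (k * k) + q⁻¹ • (kinv * kinv) = κ • 1) :
    QuantumDet (q * x ^ 2 + (q * x ^ 2)⁻¹ - κ) (lOperator k kinv e f x)
      (lOperator k kinv e f (q * x)) := by
  have hfe : f * e = κ • 1 - q • (k * k) - q⁻¹ • (kinv * kinv) := by rw [← hκ]; abel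
  unfold QuantumDet
  simp only [Fin.forall_fin_two, lOperator, Matrix.of_apply, Matrix.cons_val', Matrix.cons_val_zero,
    Matrix.cons_val_one, Matrix.cons_val_fin_one, mul_sub, sub_mul,
    smul_mul_assoc, mul_smul_comm, h.k_mul_kinv, h.kinv_mul_k, h.k_mul_e, h.kinv_mul_e, h.k_mul_f,
    h.kinv_mul_f, h.e_mul_f, hfe, br]
  and_intros <;> match_scalars <;> field_simp <;> ring

end LOperator

end Exchange

/-! ### The monodromy matrix -/

/-- The generators are scaled so that `e` and `f` are the off-diagonal blocks of the `R`-matrix. -/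
theorem isQuantumSl2_spinOne {q s : ℂ} (hq : q ≠ 0) (hs : s ^ 2 = br q * br (q ^ 2)) :
    IsQuantumSl2 q !![q, 0, 0; 0, 1, 0; 0, 0, q⁻¹] !![q⁻¹, 0, 0; 0, 1, 0; 0, 0, q]
      !![0, s, 0; 0, 0, s; 0, 0, 0] !![0, 0, 0; s, 0, 0; 0, s, 0] := by
  have hss : s * s = br q * br (q ^ 2) := by rw [← sq, hs]
  constructor <;> ext i j <;> fin_cases i <;> fin_cases j <;>
    simp [hq, hss, br, sq, mul_comm] <;> field_simp
  ring

/-- An operator on `ℂ² ⊗ V` as a two-by-two matrix of operators on `V`. -/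
def blocks {n : Type*} [Fintype n] [DecidableEq n] :
    Matrix (Fin 2 × n) (Fin 2 × n) ℂ ≃ₐ[ℂ] Matrix (Fin 2) (Fin 2) (Matrix n n ℂ) :=
  (Matrix.compAlgEquiv (Fin 2) n ℂ ℂ).symm

section Site

variable {q s x y : ℂ}

/-- The `R`-matrix of the ten-vertex model as a two-by-two matrix of operators on one site. -/
noncomputable def siteL (q s x : ℂ) : Matrix (Fin 2) (Fin 2) (Matrix (Fin 3) (Fin 3) ℂ) :=
  blocks (R12 q s x)

theorem siteL_eq (q s x : ℂ) : siteL q s x =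
    !![!![br (q ^ 2 * x), 0, 0; 0, br (q * x), 0; 0, 0, br x], !![0, 0, 0; s, 0, 0; 0, s, 0];
      !![0, s, 0; 0, 0, s; 0, 0, 0], !![br x, 0, 0; 0, br (q * x), 0; 0, 0, br (q ^ 2 * x)]] := by
  ext α β a b
  fin_cases α <;> fin_cases β <;> fin_cases a <;> fin_cases b <;> rfl

theorem siteL_eq_lOperator (hq : q ≠ 0) (x : ℂ) :
    siteL q s x = lOperator !![q, 0, 0; 0, 1, 0; 0, 0, q⁻¹] !![q⁻¹, 0, 0; 0, 1, 0; 0, 0, q]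
      !![0, s, 0; 0, 0, s; 0, 0, 0] !![0, 0, 0; s, 0, 0; 0, s, 0] (q * x) := by
  have hbr : br (q ^ 2 * x) = q * x * q - x⁻¹ * q⁻¹ * q⁻¹ := by
    rw [br, mul_inv]
    ring
  have hbr' : br x = q * x * q⁻¹ - x⁻¹ * q⁻¹ * q := by
    rw [br, mul_right_comm q, mul_inv_cancel₀ hq, one_mul, inv_mul_cancel_right₀ hq]
  have hbr'' : br (q * x) = q * x - x⁻¹ * q⁻¹ := by rw [br, mul_inv_rev]
  simp [siteL_eq, lOperator, hbr, hbr', hbr'']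

theorem siteL_exchange (hq : q ≠ 0) (hs : s ^ 2 = br q * br (q ^ 2)) (hx : x ≠ 0) (hy : y ≠ 0) :
    Exchange q (x / y) (siteL q s x) (siteL q s y) := by
  rw [siteL_eq_lOperator hq, siteL_eq_lOperator hq, ← mul_div_mul_left x y hq]
  exact (isQuantumSl2_spinOne hq hs).exchange hq (mul_ne_zero hq hx) (mul_ne_zero hq hy)

theorem siteL_quantumDet (hq : q ≠ 0) (hs : s ^ 2 = br q * br (q ^ 2)) (hx : x ≠ 0) :
    QuantumDet (br (q ^ 2 * x) * br (q⁻¹ * x)) (siteL q s (q⁻¹ * x)) (siteL q s x) := by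
  have casimir : !![0, 0, 0; s, 0, 0; 0, s, 0] * !![0, s, 0; 0, 0, s; 0, 0, 0] +
      q • (!![q, 0, 0; 0, 1, 0; 0, 0, q⁻¹] * !![q, 0, 0; 0, 1, 0; 0, 0, q⁻¹]) +
      q⁻¹ • (!![q⁻¹, 0, 0; 0, 1, 0; 0, 0, q] * !![q⁻¹, 0, 0; 0, 1, 0; 0, 0, q]) =
      (q ^ 3 + (q ^ 3)⁻¹) • (1 : Matrix (Fin 3) (Fin 3) ℂ) := by
    have hss : s * s = br q * br (q ^ 2) := by rw [← sq, hs]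
    ext i j
    fin_cases i <;> fin_cases j <;> simp [hss, br] <;> field_simp <;> ring
  rw [siteL_eq_lOperator hq, siteL_eq_lOperator hq, mul_inv_cancel_left₀ hq]
  convert (isQuantumSl2_spinOne hq hs).quantumDet hq hx casimir using 1
  simp only [br]
  field_simp
  ring

theorem siteL_transpose (α β : Fin 2) : (siteL q s x α β)ᵀ = siteL q s x β α := by
  ext a b
  fin_cases α <;> fin_cases β <;> fin_cases a <;> fin_cases b <;> rfl

end Site

section SiteOp

variable {N : ℕ} {i j : Fin N} {X Y : Matrix (Fin 3) (Fin 3) ℂ} {σ τ : Conf N}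

/-- The operator that acts as `X` on the `j`-th factor of `(ℂ³)^{⊗N}`. -/
def siteOp (j : Fin N) (X : Matrix (Fin 3) (Fin 3) ℂ) : Matrix (Conf N) (Conf N) ℂ :=
  Matrix.of fun σ τ => if ∀ k, k ≠ j → σ k = τ k then X (σ j) (τ j) else 0

theorem siteOp_mulVec (j : Fin N) (X : Matrix (Fin 3) (Fin 3) ℂ) (v : Conf N → ℂ) (σ : Conf N) :
    (siteOp j X *ᵥ v) σ = ∑ a, X (σ j) a * v (Function.update σ j a) := by
  refine (Finset.sum_of_injOn (Function.update σ j) (Function.update_injective σ j).injOn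
    (by simp) (fun τ _ hτ => ?_) fun a _ => ?_).symm
  · have hne : ¬∀ k, k ≠ j → σ k = τ k := fun h =>
      hτ ⟨τ j, by simp, Function.update_eq_iff.2 ⟨rfl, h⟩⟩
    simp only [siteOp, Matrix.of_apply, if_neg hne, zero_mul]
  · have heq : ∀ k, k ≠ j → σ k = Function.update σ j a k := fun k hk => by
      rw [Function.update_of_ne hk]
    simp only [siteOp, Matrix.of_apply, if_pos heq, Function.update_self]

theorem siteOp_mul (j : Fin N) (X Y : Matrix (Fin 3) (Fin 3) ℂ) :
    siteOp j (X * Y) = siteOp j X * siteOp j Y := by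
  refine Matrix.ext_of_mulVec_single fun τ => ?_
  rw [← Matrix.mulVec_mulVec]
  funext σ
  simp only [siteOp_mulVec, Function.update_self, Function.update_idem, Matrix.mul_apply,
    Finset.sum_mul, Finset.mul_sum, mul_assoc]
  exact Finset.sum_comm

theorem siteOp_one (j : Fin N) : siteOp j 1 = (1 : Matrix (Conf N) (Conf N) ℂ) := by
  refine Matrix.ext_of_mulVec_single fun τ => ?_
  funext σ
  simp only [siteOp_mulVec, Matrix.one_apply, ite_mul, one_mul, zero_mul, Finset.sum_ite_eq,
    Finset.mem_univ, if_true, Function.update_eq_self, Matrix.one_mulVec]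

/-- The embedding of the operators on one site into the operators on `(ℂ³)^{⊗N}`. -/
def siteHom (j : Fin N) : Matrix (Fin 3) (Fin 3) ℂ →ₐ[ℂ] Matrix (Conf N) (Conf N) ℂ :=
  AlgHom.ofLinearMap
    { toFun := siteOp j
      map_add' X Y := by
        ext σ τ
        simp only [siteOp, Matrix.of_apply, Matrix.add_apply, ite_add_zero]
      map_smul' c X := by
        ext σ τ
        simp only [siteOp, Matrix.of_apply, Matrix.smul_apply, smul_ite, smul_zero,
          RingHom.id_apply] }
    (siteOp_one j) (siteOp_mul j)

theorem siteHom_apply (j : Fin N) (X : Matrix (Fin 3) (Fin 3) ℂ) (σ τ : Conf N) :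
    siteHom j X σ τ = if ∀ k, k ≠ j → σ k = τ k then X (σ j) (τ j) else 0 := rfl

theorem siteHom_mulVec (j : Fin N) (X : Matrix (Fin 3) (Fin 3) ℂ) (v : Conf N → ℂ) (σ : Conf N) :
    (siteHom j X *ᵥ v) σ = ∑ a, X (σ j) a * v (Function.update σ j a) :=
  siteOp_mulVec j X v σ

theorem siteHom_commute (hij : i ≠ j) (X Y : Matrix (Fin 3) (Fin 3) ℂ) :
    Commute (siteHom i X) (siteHom j Y) := by
  refine Matrix.ext_of_mulVec_single fun τ => ?_
  rw [← Matrix.mulVec_mulVec, ← Matrix.mulVec_mulVec]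
  funext σ
  simp only [siteHom_mulVec, Finset.mul_sum, Function.update_of_ne hij,
    Function.update_of_ne hij.symm]
  rw [Finset.sum_comm]
  refine Finset.sum_congr rfl fun a _ => Finset.sum_congr rfl fun b _ => ?_
  rw [Function.update_comm hij, mul_left_comm]

theorem siteHom_mulVec_allUp {x : ℂ} (h : ∀ a, X a 0 = if a = 0 then x else 0) :
    siteHom j X *ᵥ allUp N = x • allUp N := by
  have hallUp : ∀ (σ : Conf N) (a : Fin 3), a ≠ 0 → allUp N (Function.update σ j a) = 0 :=
    fun σ a ha => Pi.single_eq_of_ne (fun e => ha (by simpa using congrFun e j)) _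
  funext σ
  rw [siteHom_mulVec, Finset.sum_eq_single 0 (fun a _ ha => by rw [hallUp σ a ha, mul_zero])
    (by simp), h, Pi.smul_apply, smul_eq_mul]
  by_cases hσ : σ j = 0
  · rw [if_pos hσ, ← hσ, Function.update_eq_self]
  · rw [if_neg hσ, zero_mul, ← Function.update_eq_self j σ, hallUp σ _ hσ, mul_zero]

theorem siteHom_transpose (j : Fin N) (X : Matrix (Fin 3) (Fin 3) ℂ) :
    (siteHom j X)ᵀ = siteHom j Xᵀ := by
  ext σ τ
  simp only [siteHom_apply, Matrix.transpose_apply, eq_comm]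

end SiteOp

section Monodromy

variable {N : ℕ} {q s : ℂ} {w : Fin N → ℂ} {j : Fin N} {l : List (Fin N)}

/-- The factor of the monodromy matrix that belongs to the `j`-th site. -/
noncomputable def factor (q s : ℂ) (w : Fin N → ℂ) (j : Fin N) (z : ℂ) :
    Matrix (Fin 2) (Fin 2) (Matrix (Conf N) (Conf N) ℂ) :=
  (siteL q s (q⁻¹ * z / w j)).map (siteHom j)

/-- The product of the factors of the monodromy matrix along a list of sites.  The monodromy matrix
itself belongs to the decreasing list of all sites, its transpose to the increasing one. -/
noncomputable def partialMonodromy (q s : ℂ) (w : Fin N → ℂ) (l : List (Fin N)) (z : ℂ) :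
    Matrix (Fin 2) (Fin 2) (Matrix (Conf N) (Conf N) ℂ) :=
  (l.map fun j => factor q s w j z).prod

theorem blocks_monodromy (z : ℂ) :
    blocks (monodromy q s w z) = partialMonodromy q s w (List.finRange N).reverse z := by
  rw [monodromy, map_list_prod, partialMonodromy, List.ofFn_eq_map, List.map_reverse,
    List.map_map, List.map_reverse]
  rfl

theorem partialMonodromy_nil (z : ℂ) : partialMonodromy q s w [] z = 1 := rfl

theorem partialMonodromy_cons (j : Fin N) (l : List (Fin N)) (z : ℂ) :
    partialMonodromy q s w (j :: l) z = factor q s w j z * partialMonodromy q s w l z := by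
  rw [partialMonodromy, List.map_cons, List.prod_cons, partialMonodromy]

theorem partialMonodromy_concat (j : Fin N) (l : List (Fin N)) (z : ℂ) :
    partialMonodromy q s w (l ++ [j]) z = partialMonodromy q s w l z * factor q s w j z := by
  rw [partialMonodromy, List.map_append, List.prod_append, List.map_singleton,
    List.prod_singleton, partialMonodromy]

theorem factor_transpose (z : ℂ) (α β : Fin 2) :
    (factor q s w j z α β)ᵀ = factor q s w j z β α := by
  rw [factor, Matrix.map_apply, Matrix.map_apply, siteHom_transpose, siteL_transpose]

theorem partialMonodromy_transpose (z : ℂ) (α β : Fin 2) :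
    (partialMonodromy q s w l z α β)ᵀ = partialMonodromy q s w l.reverse z β α := by
  induction l generalizing α β with
  | nil =>
    rw [List.reverse_nil, partialMonodromy_nil, Matrix.one_apply, Matrix.one_apply]
    split_ifs <;> simp_all
  | cons j l ih =>
    simp only [List.reverse_cons, partialMonodromy_concat, partialMonodromy_cons, Matrix.mul_apply,
      Matrix.transpose_sum, Matrix.transpose_mul, factor_transpose, ih]

theorem factor_commute_partialMonodromy (hj : j ∉ l) (z z' : ℂ) (α β γ δ : Fin 2) :
    Commute (factor q s w j z α β) (partialMonodromy q s w l z' γ δ) := by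
  induction l generalizing γ δ with
  | nil =>
    rw [partialMonodromy_nil, Matrix.one_apply]
    split_ifs
    exacts [Commute.one_right _, Commute.zero_right _]
  | cons k l ih =>
    rw [List.mem_cons, not_or] at hj
    rw [partialMonodromy_cons, Matrix.mul_apply]
    exact Commute.sum_right _ _ _ fun ε _ =>
      (siteHom_commute hj.1 _ _).mul_right (ih hj.2 ε δ)

theorem siteParameter_ne_zero (hq : q ≠ 0) (hw : ∀ i, w i ≠ 0) {z : ℂ} (hz : z ≠ 0) :
    q⁻¹ * z / w j ≠ 0 :=
  div_ne_zero (mul_ne_zero (inv_ne_zero hq) hz) (hw j)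

theorem partialMonodromy_exchange (hq : q ≠ 0) (hs : s ^ 2 = br q * br (q ^ 2))
    (hw : ∀ i, w i ≠ 0) {u v : ℂ} (hu : u ≠ 0) (hv : v ≠ 0) (hl : l.Nodup) :
    Exchange q (u / v) (partialMonodromy q s w l u) (partialMonodromy q s w l v) := by
  induction l with
  | nil => exact Exchange.one q (u / v)
  | cons j l ih =>
    rw [List.nodup_cons] at hl
    have hratio : q⁻¹ * u / w j / (q⁻¹ * v / w j) = u / v := by
      rw [div_div_div_cancel_right₀ (hw j), mul_div_mul_left _ _ (inv_ne_zero hq)]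
    have hfactor : Exchange q (u / v) (factor q s w j u) (factor q s w j v) :=
      hratio ▸ (siteL_exchange hq hs (siteParameter_ne_zero hq hw hu)
        (siteParameter_ne_zero hq hw hv)).map (siteHom j)
    rw [partialMonodromy_cons, partialMonodromy_cons]
    exact hfactor.mul (ih hl.2)
      (fun _ _ _ _ => (factor_commute_partialMonodromy hl.1 _ _ _ _ _ _).symm)
      (fun _ _ _ _ => (factor_commute_partialMonodromy hl.1 _ _ _ _ _ _).symm)

theorem partialMonodromy_quantumDet (hq : q ≠ 0) (hs : s ^ 2 = br q * br (q ^ 2))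
    (hw : ∀ i, w i ≠ 0) {v : ℂ} (hv : v ≠ 0) (hl : l.Nodup) :
    QuantumDet (l.map fun j => br (q * v / w j) * br (q⁻¹ * (q⁻¹ * v) / w j)).prod
      (partialMonodromy q s w l (q⁻¹ * v)) (partialMonodromy q s w l v) := by
  induction l with
  | nil => exact QuantumDet.one
  | cons j l ih =>
    rw [List.nodup_cons] at hl
    have hfactor : QuantumDet (br (q * v / w j) * br (q⁻¹ * (q⁻¹ * v) / w j))
        (factor q s w j (q⁻¹ * v)) (factor q s w j v) := by
      have h := (siteL_quantumDet hq hs (siteParameter_ne_zero (j := j) hq hw hv)).map (siteHom j)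
      rwa [show q ^ 2 * (q⁻¹ * v / w j) = q * v / w j by field_simp,
        ← mul_div_assoc q⁻¹ (q⁻¹ * v)] at h
    rw [partialMonodromy_cons, partialMonodromy_cons, List.map_cons, List.prod_cons]
    exact hfactor.mul (ih hl.2)
      fun _ _ _ _ => (factor_commute_partialMonodromy hl.1 _ _ _ _ _ _).symm

theorem factor_one_zero_mulVec_allUp (z : ℂ) : factor q s w j z 1 0 *ᵥ allUp N = 0 := by
  rw [factor, Matrix.map_apply, siteHom_mulVec_allUp (x := 0), zero_smul]
  intro a
  fin_cases a <;> rfl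

theorem factor_one_one_mulVec_allUp (z : ℂ) :
    factor q s w j z 1 1 *ᵥ allUp N = br (q⁻¹ * z / w j) • allUp N := by
  rw [factor, Matrix.map_apply, siteHom_mulVec_allUp]
  intro a
  fin_cases a <;> rfl

theorem partialMonodromy_mulVec_allUp (z : ℂ) (hl : l.Nodup) :
    partialMonodromy q s w l z 1 0 *ᵥ allUp N = 0 ∧
      partialMonodromy q s w l z 1 1 *ᵥ allUp N =
        (l.map fun j => br (q⁻¹ * z / w j)).prod • allUp N := by
  induction l with
  | nil => simp [partialMonodromy_nil]
  | cons j l ih =>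
    rw [List.nodup_cons] at hl
    obtain ⟨hC, hD⟩ := ih hl.2
    have hfactor : ∀ α,
        factor q s w j z 1 0 *ᵥ (partialMonodromy q s w l z 0 α *ᵥ allUp N) = 0 := fun α => by
      rw [Matrix.mulVec_mulVec, (factor_commute_partialMonodromy hl.1 _ _ _ _ _ _).eq,
        ← Matrix.mulVec_mulVec, factor_one_zero_mulVec_allUp, Matrix.mulVec_zero]
    simp only [partialMonodromy_cons, Matrix.mul_apply, Fin.sum_univ_two, Matrix.add_mulVec,
      ← Matrix.mulVec_mulVec, hfactor, hC, hD, Matrix.mulVec_zero, Matrix.mulVec_smul,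
      factor_one_one_mulVec_allUp, smul_smul, zero_add, List.map_cons, List.prod_cons, true_and]
    rw [mul_comm]

theorem siteL_mem_trigPoly (c : ℂ) (α β : Fin 2) (a b : Fin 3) :
    (fun z => siteL q s (c * z) α β a b) ∈ trigPoly ((if α = β then 1 else 0) + 1) := by
  have hbr : ∀ k, (fun z => br (k * (c * z))) ∈ trigPoly 2 := fun k => by
    simpa only [← mul_assoc] using br_mem_trigPoly (k * c)
  simp only [siteL_eq]
  fin_cases α <;> fin_cases β <;> fin_cases a <;> fin_cases b <;>
    first
      | exact zero_mem _
      | exact const_mem_trigPoly s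
      | exact hbr _
      | exact br_mem_trigPoly c

theorem factor_mem_trigPoly (α β : Fin 2) (σ τ : Conf N) :
    (fun z => factor q s w j z α β σ τ) ∈ trigPoly ((if α = β then 1 else 0) + 1) := by
  have happly : ∀ z, factor q s w j z α β σ τ =
      if ∀ k, k ≠ j → σ k = τ k then siteL q s (q⁻¹ / w j * z) α β (σ j) (τ j) else 0 := fun z => by
    rw [← mul_div_right_comm]
    rfl
  rw [funext happly]
  by_cases h : ∀ k, k ≠ j → σ k = τ k
  · simpa only [if_pos h] using siteL_mem_trigPoly (q⁻¹ / w j) α β (σ j) (τ j)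
  · simp only [if_neg h]
    exact zero_mem _

theorem partialMonodromy_mem_trigPoly (l : List (Fin N)) (α β : Fin 2) (σ τ : Conf N) :
    (fun z => partialMonodromy q s w l z α β σ τ) ∈
      trigPoly (l.length + if α = β then 1 else 0) := by
  induction l generalizing α β σ τ with
  | nil =>
    simp only [partialMonodromy_nil, Matrix.one_apply, List.length_nil, zero_add]
    split_ifs
    exacts [const_mem_trigPoly _, zero_mem _]
  | cons j l ih =>
    have hexpand : (fun z => partialMonodromy q s w (j :: l) z α β σ τ) =
        ∑ γ, ∑ ρ, (fun z => factor q s w j z α γ σ ρ) *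
          fun z => partialMonodromy q s w l z γ β ρ τ := by
      funext z
      simp only [partialMonodromy_cons, Matrix.mul_apply, Matrix.sum_apply, Finset.sum_apply,
        Pi.mul_apply]
    rw [hexpand]
    refine Submodule.sum_mem _ fun γ _ => Submodule.sum_mem _ fun ρ _ => ?_
    have hmul := mul_mem_trigPoly (factor_mem_trigPoly (q := q) (s := s) (w := w) (j := j) α γ σ ρ)
      (ih γ β ρ τ)
    -- There are only two spins, so `[α = γ] + [γ = β]` is `[α = β] ± 1`.
    have hdeg : ∀ α β γ : Fin 2, (if α = γ then 1 else 0) + (if γ = β then 1 else 0) =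
          (if α = β then 1 else 0) + 1 ∨
        (if α = γ then 1 else 0) + (if γ = β then 1 else 0) + 1 = if α = β then 1 else 0 := by
      decide
    rw [List.length_cons]
    obtain h | h := hdeg α β γ
    · convert hmul using 2
      omega
    · convert trigPoly_le_add_two _ hmul using 2
      omega

end Monodromy

/-! ### The height states of the ten-vertex model -/

section HeightProd

variable {N : ℕ} {M : Type*} [Monoid M] {X : Fin N → ℕ → M}

/-- The product over `j` of the first `h j` members of the sequence `X j`. -/
def heightProd (X : Fin N → ℕ → M) (h : Fin N → ℕ) : M :=
  (List.ofFn fun j => ((List.range (h j)).map (X j)).prod).prod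

theorem heightProd_zero (X : Fin N → ℕ → M) : heightProd X 0 = 1 := by
  simp [heightProd]

theorem prod_ofFn_eq_mul {b : M} {f g : Fin N → M} {j : Fin N} (hj : g j = b * f j)
    (hne : ∀ i, i ≠ j → g i = f i) (hb : ∀ i, Commute b (f i)) :
    (List.ofFn g).prod = b * (List.ofFn f).prod := by
  induction N with
  | zero => exact j.elim0
  | succ N ih =>
    rw [List.ofFn_succ, List.ofFn_succ, List.prod_cons, List.prod_cons]
    induction j using Fin.cases with
    | zero =>
      have htail : (fun i : Fin N => g i.succ) = fun i => f i.succ :=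
        funext fun i => hne _ (Fin.succ_ne_zero i)
      rw [hj, htail, mul_assoc]
    | succ j =>
      rw [ih (f := fun i => f i.succ) (j := j) hj
        (fun i hi => hne _ ((Fin.succ_injective _).ne hi)) fun i => hb _,
        hne _ (Fin.succ_ne_zero j).symm, (hb 0).symm.left_comm]

theorem commute_prod_range {y : M} (hy : ∀ j k, Commute y (X j k)) (j : Fin N) (m : ℕ) :
    Commute y ((List.range m).map (X j)).prod :=
  Commute.list_prod_right _ _ (List.forall_mem_map.2 fun k _ => hy j k)

theorem commute_heightProd {y : M} (hy : ∀ j k, Commute y (X j k)) (h : Fin N → ℕ) :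
    Commute y (heightProd X h) :=
  Commute.list_prod_right _ _ (List.forall_mem_ofFn_iff.2 fun j => commute_prod_range hy j _)

theorem heightProd_add_single (hX : ∀ i j k l, Commute (X i k) (X j l)) (h : Fin N → ℕ)
    (j : Fin N) : heightProd X (h + Pi.single j 1) = X j (h j) * heightProd X h := by
  have hcomm : ∀ i m, Commute (X j (h j)) ((List.range m).map (X i)).prod :=
    commute_prod_range fun i k => hX j i (h j) k
  refine prod_ofFn_eq_mul (j := j) ?_ (fun i hi => by simp [hi]) fun i => hcomm i _
  rw [Pi.add_apply, Pi.single_eq_same, List.prod_range_succ, (hcomm j _).eq]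

theorem heightProd_transpose {n R : Type*} [Fintype n] [DecidableEq n] [CommSemiring R]
    {X : Fin N → ℕ → Matrix n n R} (hX : ∀ i j k l, Commute (X i k) (X j l)) :
    ∀ h ≤ 2, (heightProd X h)ᵀ = heightProd (fun j k => (X j k)ᵀ) h := by
  have hX' : ∀ i j k l, Commute (X i k)ᵀ (X j l)ᵀ := fun i j k l => by
    rw [Commute, SemiconjBy, ← Matrix.transpose_mul, ← Matrix.transpose_mul, (hX i j k l).eq]
  refine heights_induction (by rw [heightProd_zero, heightProd_zero, Matrix.transpose_one])
    fun g j _ _ ih => ?_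
  rw [heightProd_add_single hX, heightProd_add_single hX', Matrix.transpose_mul, ih]
  exact (commute_heightProd (fun i k => hX' j i (g j) k) g).eq.symm

end HeightProd

section HeightStates

variable {N : ℕ} {q s : ℂ} {w : Fin N → ℂ} {h : Fin N → ℕ} {j : Fin N} {l : List (Fin N)}

theorem GenericInhom.prod_br_zpow_mul_div_ne_zero (hq : q ≠ 0) (hq4 : q ^ 4 ≠ 1)
    (hw : GenericInhom q w) (j : Fin N) {m : ℤ} (hm : m ∣ 2) :
    ∏ i, br (q ^ m * w j / w i) ≠ 0 :=
  Finset.prod_ne_zero_iff.2 fun i _ => hw.br_zpow_mul_div_ne_zero_of_dvd hq hq4 hm j i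

theorem aFun_node_ne_zero (hq : q ≠ 0) (hq4 : q ^ 4 ≠ 1) (hw : GenericInhom q w) (hj : h j ≤ 1) :
    aFun q w (node q w h j) ≠ 0 := by
  have hqz : q * node q w h j = q ^ (2 - (h j : ℤ)) * w j := by
    rw [node, ← mul_assoc, ← zpow_one_add₀ hq]
    congr 2
    ring
  rw [aFun, hqz]
  exact hw.prod_br_zpow_mul_div_ne_zero hq hq4 j (by interval_cases h j <;> decide)

theorem dFun_node_ne_zero (hq : q ≠ 0) (hq4 : q ^ 4 ≠ 1) (hw : GenericInhom q w) (hj : h j ≤ 1) :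
    dFun q w (q⁻¹ * node q w h j) ≠ 0 := by
  have hqz : q⁻¹ * (q⁻¹ * node q w h j) = q ^ (-1 - (h j : ℤ)) * w j := by
    rw [node, ← mul_assoc, ← mul_assoc, ← zpow_neg_one, ← zpow_add₀ hq, ← zpow_add₀ hq]
    congr 2
    ring
  rw [dFun, hqz]
  exact hw.prod_br_zpow_mul_div_ne_zero hq hq4 j (by interval_cases h j <;> decide)

theorem dFun_q_mul_eq_zero (hq : q ≠ 0) (hw : ∀ i, w i ≠ 0) (j : Fin N) :
    dFun q w (q * w j) = 0 := by
  refine Finset.prod_eq_zero (Finset.mem_univ j) ?_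
  rw [inv_mul_cancel_left₀ hq, div_self (hw j), br_one]

theorem prod_map_of_perm_finRange (hl : l.Perm (List.finRange N)) (f : Fin N → ℂ) :
    (l.map f).prod = ∏ i, f i := by
  rw [(hl.map f).prod_eq, ← List.ofFn_eq_map, List.prod_ofFn]

theorem br_q_mul_div_ne_zero_or (hq : q ≠ 0) (hq4 : q ^ 4 ≠ 1) {u v : ℂ} (hu : u ≠ 0)
    (hv : v ≠ 0) : br (q * (u / v)) ≠ 0 ∨ br (q * (v / u)) ≠ 0 := by
  rw [Ne, Ne, br_eq_zero_iff (mul_ne_zero hq (div_ne_zero hu hv)),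
    br_eq_zero_iff (mul_ne_zero hq (div_ne_zero hv hu)), ← not_and_or]
  rintro ⟨huv, hvu⟩
  refine hq4 ?_
  calc q ^ 4 = (q * (u / v)) ^ 2 * (q * (v / u)) ^ 2 := by field_simp
    _ = 1 := by rw [huv, hvu, one_mul]

theorem partialMonodromy_zero_one_commute (hq : q ≠ 0) (hq4 : q ^ 4 ≠ 1)
    (hs : s ^ 2 = br q * br (q ^ 2)) (hw : ∀ i, w i ≠ 0) (hl : l.Nodup) {u v : ℂ} (hu : u ≠ 0)
    (hv : v ≠ 0) : Commute (partialMonodromy q s w l u 0 1) (partialMonodromy q s w l v 0 1) := by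
  rcases br_q_mul_div_ne_zero_or hq hq4 hu hv with h | h
  · exact smul_right_injective _ h (partialMonodromy_exchange hq hs hw hu hv hl).BB
  · exact (smul_right_injective _ h (partialMonodromy_exchange hq hs hw hv hu hl).BB).symm

/-- The height states created from the reference state by the operators `B`, normalised by `c`.
Arbitrary natural heights are allowed so that a height can be raised without a side condition. -/
noncomputable def heightState (q : ℂ) (w : Fin N → ℂ) (B : ℂ → Matrix (Conf N) (Conf N) ℂ)
    (c : ℂ → ℂ) (h : Fin N → ℕ) : Conf N → ℂ :=
  heightProd (fun j k => (c (q ^ (1 - (k : ℤ)) * w j))⁻¹ • B (q ^ (1 - (k : ℤ)) * w j)) h *ᵥ allUp N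

theorem heightState_zero (B : ℂ → Matrix (Conf N) (Conf N) ℂ) (c : ℂ → ℂ) :
    heightState q w B c 0 = allUp N := by
  rw [heightState, heightProd_zero, Matrix.one_mulVec]

theorem commute_smul_node {B : ℂ → Matrix (Conf N) (Conf N) ℂ} (hq : q ≠ 0) (hw : ∀ i, w i ≠ 0)
    (hB : ∀ u v, u ≠ 0 → v ≠ 0 → Commute (B u) (B v)) (c : ℂ → ℂ) (i j : Fin N) (k m : ℕ) :
    Commute ((c (q ^ (1 - (k : ℤ)) * w i))⁻¹ • B (q ^ (1 - (k : ℤ)) * w i))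
      ((c (q ^ (1 - (m : ℤ)) * w j))⁻¹ • B (q ^ (1 - (m : ℤ)) * w j)) :=
  ((hB _ _ (mul_ne_zero (zpow_ne_zero _ hq) (hw i))
    (mul_ne_zero (zpow_ne_zero _ hq) (hw j))).smul_left _).smul_right _

theorem heightSystem (hq : q ≠ 0) (hq4 : q ^ 4 ≠ 1) (hs : s ^ 2 = br q * br (q ^ 2))
    (hw : GenericInhom q w) (hl : l.Perm (List.finRange N)) {c e : ℂ → ℂ}
    (hce : ∀ v, c v * e v = aFun q w v * dFun q w (q⁻¹ * v))
    (hc : ∀ h j, h j ≤ 1 → c (node q w h j) ≠ 0) :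
    HeightSystem q w (fun z => partialMonodromy q s w l z 0 0)
      (fun z => partialMonodromy q s w l z 0 1) (fun z => partialMonodromy q s w l z 1 0)
      (fun z => partialMonodromy q s w l z 1 1) c e
      (heightState q w (fun z => partialMonodromy q s w l z 0 1) c) := by
  have hnodup : l.Nodup := hl.nodup_iff.2 (List.nodup_finRange N)
  refine ⟨hq, hq4, hw, ?_, ?_, ?_, ?_, ?_, ?_, hc⟩
  · intro u v hu hv
    rw [mul_div_assoc]
    exact (partialMonodromy_exchange hq hs hw.1 hu hv hnodup).DB
  · exact fun u v hu hv => (partialMonodromy_exchange hq hs hw.1 hu hv hnodup).CB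
  · intro v hv
    have hdet := partialMonodromy_quantumDet hq hs hw.1 hv hnodup 0 1
    rw [prod_map_of_perm_finRange hl, Finset.prod_mul_distrib] at hdet
    simpa [aFun, dFun, hce] using hdet
  · intro j
    rw [heightState_zero, (partialMonodromy_mulVec_allUp _ hnodup).2, prod_map_of_perm_finRange hl,
      ← dFun, dFun_q_mul_eq_zero hq hw.1, zero_smul]
  · intro u _
    rw [heightState_zero, (partialMonodromy_mulVec_allUp u hnodup).1]
  · intro h j hj
    rw [heightState, heightState, heightProd_add_single (commute_smul_node hq hw.1
      (fun u v => partialMonodromy_zero_one_commute hq hq4 hs hw.1 hnodup) c),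
      ← Matrix.mulVec_mulVec, Matrix.smul_mulVec]
    exact (smul_inv_smul₀ (hc h j hj) _).symm

theorem opB_eq (q s : ℂ) (w : Fin N → ℂ) :
    opB q s w = fun z => partialMonodromy q s w (List.finRange N).reverse z 0 1 := by
  funext z
  rw [← blocks_monodromy]
  rfl

theorem opC_eq (q s : ℂ) (w : Fin N → ℂ) :
    opC q s w = fun z => partialMonodromy q s w (List.finRange N).reverse z 1 0 := by
  funext z
  rw [← blocks_monodromy]
  rfl

theorem opC_transpose_eq (q s : ℂ) (w : Fin N → ℂ) :
    (fun z => (opC q s w z)ᵀ) = fun z => partialMonodromy q s w (List.finRange N) z 0 1 := by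
  simp only [opC_eq, partialMonodromy_transpose, List.reverse_reverse]

theorem opB_commute (hq : q ≠ 0) (hq4 : q ^ 4 ≠ 1) (hs : s ^ 2 = br q * br (q ^ 2))
    (hw : ∀ i, w i ≠ 0) (u v : ℂ) (hu : u ≠ 0) (hv : v ≠ 0) :
    Commute (opB q s w u) (opB q s w v) := by
  rw [opB_eq]
  exact partialMonodromy_zero_one_commute hq hq4 hs hw
    (List.nodup_reverse.2 (List.nodup_finRange N)) hu hv

theorem opC_commute (hq : q ≠ 0) (hq4 : q ^ 4 ≠ 1) (hs : s ^ 2 = br q * br (q ^ 2))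
    (hw : ∀ i, w i ≠ 0) (u v : ℂ) (hu : u ≠ 0) (hv : v ≠ 0) :
    Commute (opC q s w u) (opC q s w v) := by
  have hcomm := partialMonodromy_zero_one_commute hq hq4 hs hw (List.nodup_finRange N) hv hu
  rw [← congrFun (opC_transpose_eq q s w) u, ← congrFun (opC_transpose_eq q s w) v, Commute,
    SemiconjBy, ← Matrix.transpose_mul, ← Matrix.transpose_mul] at hcomm
  exact Matrix.transpose_injective hcomm

/-- The states `‖h⟩⟩`, for arbitrary natural heights. -/
noncomputable def ketState (q s : ℂ) (w : Fin N → ℂ) : (Fin N → ℕ) → Conf N → ℂ :=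
  heightState q w (opB q s w) (aFun q w)

/-- The states `⟨⟨h‖`, for arbitrary natural heights, as vectors created by the transposes of the
operators `𝓒`. -/
noncomputable def braState (q s : ℂ) (w : Fin N → ℂ) : (Fin N → ℕ) → Conf N → ℂ :=
  heightState q w (fun z => (opC q s w z)ᵀ) (fun z => dFun q w (q⁻¹ * z))

theorem heightKet_eq (h : Fin N → Fin 3) : heightKet q s w h = ketState q s w (natHeights h) := rfl

theorem heightBra_eq (hq : q ≠ 0) (hq4 : q ^ 4 ≠ 1) (hs : s ^ 2 = br q * br (q ^ 2))
    (hw : ∀ i, w i ≠ 0) (h : Fin N → Fin 3) :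
    heightBra q s w h = braState q s w (natHeights h) := by
  have hnode : ∀ (k : ℕ) j, q ^ (-(k : ℤ)) * w j = q⁻¹ * (q ^ (1 - (k : ℤ)) * w j) := fun k j => by
    rw [← mul_assoc, ← zpow_neg_one, ← zpow_add₀ hq]
    congr 2
    ring
  have hprod := heightProd_transpose (commute_smul_node hq hw (opC_commute hq hq4 hs hw)
    fun z => dFun q w (q⁻¹ * z)) (natHeights h) (natHeights_le_two h)
  simp only [Matrix.transpose_smul] at hprod
  rw [braState, heightState, ← hprod, Matrix.mulVec_transpose, heightBra]
  simp only [hnode]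
  rfl

theorem opB_mem_trigPoly (σ τ : Conf N) : (fun z => opB q s w z σ τ) ∈ trigPoly N := by
  simpa [opB_eq] using
    partialMonodromy_mem_trigPoly (q := q) (s := s) (w := w) (List.finRange N).reverse 0 1 σ τ

theorem opC_mem_trigPoly (σ τ : Conf N) : (fun z => opC q s w z σ τ) ∈ trigPoly N := by
  simpa [opC_eq] using
    partialMonodromy_mem_trigPoly (q := q) (s := s) (w := w) (List.finRange N).reverse 1 0 σ τ

theorem heightPair (hq : q ≠ 0) (hq4 : q ^ 4 ≠ 1) (hs : s ^ 2 = br q * br (q ^ 2))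
    (hw : GenericInhom q w) :
    HeightPair q w (fun z => partialMonodromy q s w (List.finRange N).reverse z 0 0) (opB q s w)
      (opC q s w) (fun z => partialMonodromy q s w (List.finRange N).reverse z 1 1) (aFun q w)
      (fun z => dFun q w (q⁻¹ * z)) (ketState q s w) (braState q s w) where
  ket := by
    rw [ketState, opB_eq, opC_eq]
    exact heightSystem hq hq4 hs hw (List.reverse_perm _) (fun _ => rfl)
      fun h j => aFun_node_ne_zero hq hq4 hw
  bra := by
    have hbra := heightSystem (s := s) hq hq4 hs hw (List.Perm.refl _)
      (fun v => mul_comm (dFun q w (q⁻¹ * v)) _) fun h j => dFun_node_ne_zero hq hq4 hw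
    rw [braState, opC_transpose_eq]
    simpa only [opB_eq, partialMonodromy_transpose, List.reverse_reverse] using hbra
  trig_B := opB_mem_trigPoly
  trig_C := opC_mem_trigPoly
  vac := by
    rw [ketState, braState, heightState_zero, heightState_zero, allUp, single_one_dotProduct,
      Pi.single_eq_same]

theorem transferAD_eq (z : ℂ) :
    transferAD q s w z = Complex.I • (opB q s w z + opC q s w z) := by
  ext σ τ
  simp only [transferAD, trAux, twistAD, opB, opC, Matrix.mul_apply, Matrix.of_apply,
    Fintype.sum_prod_type, Matrix.kronecker_apply, Matrix.one_apply]
  simp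
  ring

end HeightStates

/-! ### Norms of the height states -/

section CutProducts

variable {ι : Type*} {F : ι → ι → ℂ} {I : Finset ι}

theorem prod_prod_eq_one_of_mul_swap (swap : ∀ i j, F i j * F j i = 1) (diag : ∀ i, F i i = 1) :
    ∏ i ∈ I, ∏ j ∈ I, F i j = 1 := by
  rw [← Finset.prod_product' I I F]
  refine Finset.prod_involution (fun p _ => p.swap) (fun p _ => swap p.1 p.2) ?_
    (fun p hp => Finset.mem_product.2 (Finset.mem_product.1 hp).symm) (fun p _ => p.swap_swap)
  rintro ⟨i, j⟩ - hF hij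
  obtain rfl : j = i := congrArg Prod.fst hij
  exact hF (diag j)

variable [Fintype ι] [DecidableEq ι]

/-- The product of `F i k` over the ordered pairs that are cut by `I`, that is, `i ∈ I` and
`k ∉ I`. -/
def cutProd (F : ι → ι → ℂ) (I : Finset ι) : ℂ := ∏ i ∈ I, ∏ k ∈ Iᶜ, F i k

theorem cutProd_insert (F : ι → ι → ℂ) {j : ι} (hj : j ∉ I) :
    cutProd F (insert j I) * ∏ i ∈ I, F i j = cutProd F I * ∏ k ∈ Iᶜ.erase j, F j k := by
  have split_j : cutProd F I = ∏ i ∈ I, (F i j * ∏ k ∈ Iᶜ.erase j, F i k) :=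
    Finset.prod_congr rfl fun i _ =>
      (Finset.mul_prod_erase _ _ (Finset.mem_compl.2 hj)).symm
  rw [split_j, Finset.prod_mul_distrib, cutProd, Finset.prod_insert hj, Finset.compl_insert]
  ring

theorem cutProd_eq_prod_offDiag (F : ι → ι → ℂ) (I : Finset ι) :
    cutProd F I = ∏ p ∈ (Finset.univ : Finset ι).offDiag,
      if p.1 ∈ I ∧ p.2 ∉ I then F p.1 p.2 else 1 := by
  rw [← Finset.prod_filter, cutProd, ← Finset.prod_product']
  refine Finset.prod_congr ?_ fun _ _ => rfl
  ext ⟨i, k⟩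
  simp only [Finset.mem_product, Finset.mem_compl, Finset.mem_filter, Finset.mem_offDiag,
    Finset.mem_univ, true_and]
  exact ⟨fun h => ⟨ne_of_mem_of_not_mem h.1 h.2, h⟩, fun h => h.2⟩

theorem prod_prod_eq_cutProd (swap : ∀ i j, F i j * F j i = 1) (diag : ∀ i, F i i = 1) :
    ∏ i ∈ I, ∏ j, F i j = cutProd F I := by
  simp only [← Finset.prod_mul_prod_compl I, Finset.prod_mul_distrib]
  rw [prod_prod_eq_one_of_mul_swap swap diag, one_mul, cutProd]

end CutProducts

section ExtremeHeights

variable {N : ℕ} {q : ℂ} {w : Fin N → ℂ} {I : Finset (Fin N)} {j : Fin N}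

/-- The heights that are `2` on `I` and `0` elsewhere.  The left null covector has vanishing
components at all other heights. -/
def extremeHeights (I : Finset (Fin N)) : Fin N → Fin 3 := fun i => if i ∈ I then 2 else 0

theorem extremeHeights_injective : Function.Injective (extremeHeights (N := N)) := by
  intro I J h
  ext i
  have hi := congrFun h i
  by_cases hI : i ∈ I <;> by_cases hJ : i ∈ J <;> simp_all [extremeHeights]

theorem exists_extremeHeights_eq {h : Fin N → Fin 3} (hh : ∀ i, h i ≠ 1) :
    ∃ I, extremeHeights I = h := by
  have zero_or_two : ∀ m : Fin 3, m ≠ 1 → m ≠ 2 → m = 0 := by decide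
  refine ⟨Finset.univ.filter fun i => h i = 2, funext fun i => ?_⟩
  by_cases hi : h i = 2
  · simp [extremeHeights, hi]
  · simp [extremeHeights, zero_or_two _ (hh i) hi]

theorem natHeights_extreme (I : Finset (Fin N)) (i : Fin N) :
    natHeights (extremeHeights I) i = if i ∈ I then 2 else 0 := by
  rw [natHeights, extremeHeights]
  split_ifs <;> rfl

theorem natHeights_extreme_empty : natHeights (extremeHeights (∅ : Finset (Fin N))) = 0 :=
  funext fun i => by simp [natHeights_extreme]

theorem natHeights_extreme_insert (hj : j ∉ I) :
    natHeights (extremeHeights (insert j I)) =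
      natHeights (extremeHeights I) + Pi.single j 1 + Pi.single j 1 := by
  funext i
  rcases eq_or_ne i j with rfl | hi
  · simp [natHeights_extreme, hj]
  · simp [natHeights_extreme, hi]

theorem node_extreme_of_mem {k : Fin N} (hk : k ∈ I) :
    node q w (natHeights (extremeHeights I)) k = q⁻¹ * w k := by
  rw [node, natHeights_extreme, if_pos hk]
  norm_num

theorem node_extreme_of_notMem {k : Fin N} (hk : k ∉ I) :
    node q w (natHeights (extremeHeights I)) k = q * w k :=
  node_of_eq_zero (by rw [natHeights_extreme, if_neg hk])

theorem prod_br_div_node_extreme (hj : j ∉ I) (z : ℂ) :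
    ∏ k ∈ Finset.univ.erase j, br (z / node q w (natHeights (extremeHeights I)) k) =
      (∏ k ∈ I, br (z / (q⁻¹ * w k))) * ∏ k ∈ Iᶜ.erase j, br (z / (q * w k)) := by
  have hunion : I ∪ Iᶜ.erase j = Finset.univ.erase j := by
    ext k
    by_cases hk : k ∈ I
    · simp [hk, ne_of_mem_of_not_mem hk hj]
    · simp [hk]
  rw [← hunion, Finset.prod_union
    (Finset.disjoint_left.2 fun k hk hk' => Finset.mem_compl.1 (Finset.mem_of_mem_erase hk') hk)]
  congr 1
  · exact Finset.prod_congr rfl fun k hk => by rw [node_extreme_of_mem hk]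
  · exact Finset.prod_congr rfl fun k hk => by
      rw [node_extreme_of_notMem (Finset.mem_compl.1 (Finset.mem_of_mem_erase hk))]

end ExtremeHeights

section Norms

variable {N : ℕ} {n : Type*} [Fintype n] [DecidableEq n] {q : ℂ} {w : Fin N → ℂ}
  {A B C D : ℂ → Matrix n n ℂ} {c e : ℂ → ℂ} {K L : (Fin N → ℕ) → n → ℂ}

/-- The factor that two sites with heights `2` and `0` contribute to the norm of a height
state. -/
noncomputable def normFactor (q x y : ℂ) : ℂ := br (x / y) / br ((q ^ 2)⁻¹ * x / y)

theorem normFactor_swap (q x y : ℂ) : normFactor q x y = br (y / x) / br (q ^ 2 * y / x) := by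
  rw [normFactor, br_inv_mul_div, ← inv_div y, br_inv, neg_div_neg_eq]

theorem HeightPair.norm_add_two {g : Fin N → ℕ} {j : Fin N}
    (S : HeightPair q w A B C D c e K L) (hg : g ≤ 2) (hj : g j = 0) :
    (L (g + Pi.single j 1 + Pi.single j 1) ⬝ᵥ K (g + Pi.single j 1 + Pi.single j 1)) *
        ∏ k ∈ Finset.univ.erase j, br (q⁻¹ * w j / node q w g k) =
      (L g ⬝ᵥ K g) * ∏ k ∈ Finset.univ.erase j, br (q * w j / node q w g k) := by
  have hj' : (g + Pi.single j 1 : Fin N → ℕ) j = 1 := by simp [hj]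
  have first := S.norm_add_single hg (j := j) (by omega)
  have second := S.norm_add_single (add_single_le_two hg (j := j) (by omega)) hj'.le
  rw [prod_br_div_node_add_single, prod_br_div_node_add_single, node_of_eq_one hj'] at second
  rw [node_of_eq_zero hj, inv_mul_cancel_left₀ S.ket.q_ne_zero] at first
  linear_combination second - first

theorem HeightPair.norm_extreme_insert {I : Finset (Fin N)} {j : Fin N}
    (S : HeightPair q w A B C D c e K L) (hj : j ∉ I) :
    L (natHeights (extremeHeights (insert j I))) ⬝ᵥ K (natHeights (extremeHeights (insert j I))) *
        ∏ k ∈ I, normFactor q (w k) (w j) =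
      L (natHeights (extremeHeights I)) ⬝ᵥ K (natHeights (extremeHeights I)) *
        ∏ k ∈ Iᶜ.erase j, normFactor q (w j) (w k) := by
  obtain ⟨hq, hq4, hw⟩ := And.intro S.ket.q_ne_zero
    (And.intro S.ket.q_pow_four_ne_one S.ket.genericInhom)
  have raise := S.norm_add_two (natHeights_le_two (extremeHeights I)) (j := j)
    (by rw [natHeights_extreme, if_neg hj])
  have ratio_sq (k : Fin N) : q * w j / (q⁻¹ * w k) = q ^ 2 * w j / w k := by field_simp
  have ratio_sq_inv (k : Fin N) : q⁻¹ * w j / (q * w k) = (q ^ 2)⁻¹ * w j / w k := by field_simp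
  simp only [← natHeights_extreme_insert hj, prod_br_div_node_extreme hj, ratio_sq, ratio_sq_inv,
    mul_div_mul_left _ _ (inv_ne_zero hq), mul_div_mul_left _ _ hq] at raise
  have hsq : ∏ k ∈ I, br (q ^ 2 * w j / w k) ≠ 0 :=
    Finset.prod_ne_zero_iff.2 fun k _ => hw.br_sq_mul_div_ne_zero hq hq4 j k
  have hsq_inv : ∏ k ∈ Iᶜ.erase j, br ((q ^ 2)⁻¹ * w j / w k) ≠ 0 :=
    Finset.prod_ne_zero_iff.2 fun k _ => hw.br_sq_inv_mul_div_ne_zero hq hq4 j k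
  simp only [normFactor_swap q (w _) (w j)]
  simp only [normFactor, Finset.prod_div_distrib]
  rw [mul_div_assoc', mul_div_assoc', div_eq_div_iff hsq hsq_inv]
  linear_combination raise

theorem HeightPair.norm_extreme (S : HeightPair q w A B C D c e K L) (I : Finset (Fin N)) :
    L (natHeights (extremeHeights I)) ⬝ᵥ K (natHeights (extremeHeights I)) =
      cutProd (fun i k => normFactor q (w i) (w k)) I := by
  obtain ⟨hq, hq4, hw⟩ := And.intro S.ket.q_ne_zero
    (And.intro S.ket.q_pow_four_ne_one S.ket.genericInhom)
  induction I using Finset.induction_on with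
  | empty => simp [natHeights_extreme_empty, S.vac, cutProd]
  | insert j I hj ih =>
    have factors_ne_zero : ∏ k ∈ I, normFactor q (w k) (w j) ≠ 0 :=
      Finset.prod_ne_zero_iff.2 fun k hk => div_ne_zero
        (hw.br_div_ne_zero hq (ne_of_mem_of_not_mem hk hj))
        (hw.br_sq_inv_mul_div_ne_zero hq hq4 k j)
    apply mul_right_cancel₀ factors_ne_zero
    rw [S.norm_extreme_insert hj, ih, cutProd_insert _ hj]

end Norms

/-! ### Commuting families -/

section Commuting

open Module

variable {ι 𝕜 V : Type*} [Field 𝕜] [AddCommGroup V] [Module 𝕜 V]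

theorem mapsTo_eigenspace_of_commute {f g : End 𝕜 V} (hfg : Commute f g) (μ : 𝕜) {v : V}
    (hv : v ∈ g.eigenspace μ) : f v ∈ g.eigenspace μ := by
  rw [End.mem_eigenspace_iff] at hv ⊢
  rw [← End.mul_apply, ← hfg.eq, End.mul_apply, hv, map_smul]

variable [FiniteDimensional 𝕜 V]

theorem exists_joint_eigenvector [IsAlgClosed 𝕜] {f : ι → End 𝕜 V}
    (hf : ∀ i j, Commute (f i) (f j)) {W : Submodule 𝕜 V} (hW : W ≠ ⊥)
    (hfW : ∀ i, ∀ v ∈ W, f i v ∈ W) :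
    ∃ v ∈ W, v ≠ 0 ∧ ∃ χ : ι → 𝕜, ∀ i, f i v = χ i • v := by
  obtain ⟨U, ⟨hU, hUW, hfU⟩, minimal⟩ := wellFounded_lt.has_min
    {U : Submodule 𝕜 V | U ≠ ⊥ ∧ U ≤ W ∧ ∀ i, ∀ v ∈ U, f i v ∈ U} ⟨W, hW, le_rfl, hfW⟩
  have scalar_on_U : ∀ i, ∃ μ : 𝕜, U ≤ (f i).eigenspace μ := by
    intro i
    have := Submodule.nontrivial_iff_ne_bot.2 hU
    obtain ⟨μ, hμ⟩ := End.exists_eigenvalue ((f i).restrict (hfU i))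
    obtain ⟨x, hx⟩ := hμ.exists_hasEigenvector
    have hxμ : (x : V) ∈ (f i).eigenspace μ :=
      End.mem_eigenspace_iff.2 (congrArg Subtype.val hx.apply_eq_smul)
    refine ⟨μ, inf_eq_left.1 (inf_le_left.eq_of_not_lt (minimal _ ⟨?_, ?_, ?_⟩))⟩
    · exact (Submodule.ne_bot_iff _).2 ⟨x, ⟨x.2, hxμ⟩, fun h => hx.2 (Subtype.ext h)⟩
    · exact inf_le_left.trans hUW
    · exact fun j y hy => ⟨hfU j y hy.1, mapsTo_eigenspace_of_commute (hf j i) μ hy.2⟩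
  choose χ hχ using scalar_on_U
  obtain ⟨v, hv, hv0⟩ := (Submodule.ne_bot_iff _).1 hU
  exact ⟨v, hUW hv, hv0, χ, fun i => End.mem_eigenspace_iff.1 (hχ i hv)⟩

theorem finite_joint_eigenvalues {f : ι → End 𝕜 V} (hf : ∀ i j, Commute (f i) (f j)) :
    {χ : ι → 𝕜 | ∃ v, v ≠ 0 ∧ ∀ i, f i v = χ i • v}.Finite := by
  have independent := End.independent_iInf_maxGenEigenspace_of_forall_mapsTo f
    fun i j μ => End.mapsTo_maxGenEigenspace_of_comm (hf j i) μ
  refine (WellFoundedGT.finite_ne_bot_of_iSupIndep independent).subset ?_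
  rintro χ ⟨v, hv0, hv⟩
  refine (Submodule.ne_bot_iff _).2 ⟨v, ?_, hv0⟩
  exact (End.mem_iInf_maxGenEigenspace_iff ..).2 fun i => ⟨1, by simp [hv i]⟩

theorem disjoint_ker_of_joint_eigenvalue_ne_zero [IsAlgClosed 𝕜] {f : ι → End 𝕜 V}
    (hf : ∀ i j, Commute (f i) (f j)) {W : Submodule 𝕜 V} (hfW : ∀ i, ∀ v ∈ W, f i v ∈ W) {i : ι}
    (hi : ∀ v ∈ W, v ≠ 0 → ∀ χ : ι → 𝕜, (∀ j, f j v = χ j • v) → χ i ≠ 0) :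
    Disjoint W (LinearMap.ker (f i)) := by
  rw [disjoint_iff]
  by_contra hne
  obtain ⟨v, ⟨hvW, hv⟩, hv0, χ, hχ⟩ := exists_joint_eigenvector hf hne fun j v hv =>
    ⟨hfW j v hv.1, by
      have := mapsTo_eigenspace_of_commute (hf j i) 0 (v := v) (by simpa using hv.2)
      simpa using this⟩
  have hχv := (hχ i).symm.trans hv
  exact hi v hvW hv0 χ hχ ((smul_eq_zero.1 hχv).resolve_right hv0)

theorem rootMultiplicity_charpoly_zero_eq_one {f : End 𝕜 V} {φ : Dual 𝕜 V} {ψ : V}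
    (hφ : φ ∘ₗ f = 0) (hψ : f ψ = 0) (overlap : φ ψ ≠ 0)
    (hdisj : Disjoint (LinearMap.ker φ) (LinearMap.ker f)) :
    f.charpoly.rootMultiplicity 0 = 1 := by
  have pow_kernel : ∀ k x, (f ^ k) (f x) = 0 → f x = 0 := by
    intro k
    induction k with
    | zero => exact fun x hx => hx
    | succ k ih =>
      refine fun x hx => Submodule.disjoint_def.1 hdisj _ (LinearMap.congr_fun hφ x) ?_
      rw [pow_succ, End.mul_apply] at hx
      exact ih _ hx
  have eq_smul : ∀ x, f x = 0 → x = (φ x / φ ψ) • ψ := by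
    refine fun x hx => sub_eq_zero.1 (Submodule.disjoint_def.1 hdisj _ ?_ ?_)
    · simp [overlap]
    · simp [hx, hψ]
  have span : f.maxGenEigenspace 0 = 𝕜 ∙ ψ := by
    refine le_antisymm (fun x hx => ?_) ?_
    · obtain ⟨k, hk⟩ := (End.mem_maxGenEigenspace ..).1 hx
      rw [zero_smul, sub_zero] at hk
      refine Submodule.mem_span_singleton.2 ⟨_, (eq_smul x (pow_kernel k x ?_)).symm⟩
      rw [← End.mul_apply, ← pow_succ, pow_succ', End.mul_apply, hk, map_zero]
    · rw [Submodule.span_singleton_le_iff_mem, End.mem_maxGenEigenspace]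
      exact ⟨1, by simp [hψ]⟩
  have hψ0 : ψ ≠ 0 := fun h => overlap (by rw [h, map_zero])
  rw [← LinearMap.finrank_maxGenEigenspace_eq, span, finrank_span_singleton hψ0]

theorem finite_charpoly_rootMultiplicity_zero_ne_one [IsAlgClosed 𝕜] {f : ι → End 𝕜 V}
    (hf : ∀ i j, Commute (f i) (f j)) {φ : Dual 𝕜 V} {ψ : V} (hφ : ∀ i, φ ∘ₗ f i = 0)
    (hψ : ∀ i, f i ψ = 0) (overlap : φ ψ ≠ 0)
    (finite_zeros : ∀ v, φ v = 0 → v ≠ 0 → ∀ χ : ι → 𝕜, (∀ i, f i v = χ i • v) →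
      {i | χ i = 0}.Finite) :
    {i | (f i).charpoly.rootMultiplicity 0 ≠ 1}.Finite := by
  let X : Set (ι → 𝕜) := {χ | ∃ v, φ v = 0 ∧ v ≠ 0 ∧ ∀ i, f i v = χ i • v}
  have finite_X : X.Finite :=
    (finite_joint_eigenvalues hf).subset fun χ ⟨v, _, hv⟩ => ⟨v, hv⟩
  have finite_zeros_X : (⋃ χ ∈ X, {i | χ i = 0}).Finite :=
    finite_X.biUnion fun χ ⟨v, hvφ, hv0, hv⟩ => finite_zeros v hvφ hv0 χ hv
  refine finite_zeros_X.subset fun i hmult => by_contra fun hi => hmult ?_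
  refine rootMultiplicity_charpoly_zero_eq_one (hφ i) (hψ i) overlap ?_
  refine disjoint_ker_of_joint_eigenvalue_ne_zero hf
    (fun j v _ => LinearMap.congr_fun (hφ j) v) fun v hvφ hv0 χ hχ h0 => hi ?_
  exact Set.mem_biUnion (x := χ) ⟨v, hvφ, hv0, hχ⟩ h0

end Commuting

section SimpleEigenvalue

variable {n : Type*} [Fintype n] {N : ℕ} {T : ℂ → Matrix n n ℂ} {φ ψ v : n → ℂ}

theorem finite_zeros_of_joint_eigenvalue (trig : ∀ σ τ, (fun z => T z σ τ) ∈ trigPoly N)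
    (hv0 : v ≠ 0) {χ : ℂˣ → ℂ} (hχ : ∀ z : ℂˣ, T z *ᵥ v = χ z • v) {z₀ : ℂˣ} (hz₀ : χ z₀ ≠ 0) :
    {z | χ z = 0}.Finite := by
  classical
  obtain ⟨σ, hσ⟩ := Function.ne_iff.1 hv0
  have value : ∀ z : ℂˣ, Pi.single σ 1 ⬝ᵥ (T z *ᵥ v) = χ z * v σ := fun z => by
    rw [hχ, single_one_dotProduct, Pi.smul_apply, smul_eq_mul]
  have zeros := finite_zeros_of_mem_trigPoly (dotProduct_mulVec_mem_trigPoly trig _ v) z₀.ne_zero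
    (by rw [value]; exact mul_ne_zero hz₀ hσ)
  refine (zeros.preimage Units.val_injective.injOn).subset fun z hz => ⟨z.ne_zero, ?_⟩
  rw [value, hz, zero_mul]

theorem finite_rootMultiplicity_ne_one [DecidableEq n]
    (trig : ∀ σ τ, (fun z => T z σ τ) ∈ trigPoly N)
    (commute : ∀ u v, u ≠ 0 → v ≠ 0 → Commute (T u) (T v))
    (hφ : ∀ z, z ≠ 0 → φ ᵥ* T z = 0)
    (hψ : ∀ v, (∀ z, z ≠ 0 → T z *ᵥ v = 0) ↔ ∃ a : ℂ, v = a • ψ) (overlap : φ ⬝ᵥ ψ ≠ 0) :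
    {z : ℂ | z ≠ 0 ∧ (T z).charpoly.rootMultiplicity 0 ≠ 1}.Finite := by
  have hψ₀ : ∀ z : ℂˣ, T z *ᵥ ψ = 0 := fun z => (hψ ψ).2 ⟨1, (one_smul _ _).symm⟩ z z.ne_zero
  have finite_zeros : ∀ v, φ ⬝ᵥ v = 0 → v ≠ 0 → ∀ χ : ℂˣ → ℂ,
      (∀ z : ℂˣ, T z *ᵥ v = χ z • v) → {z | χ z = 0}.Finite := by
    intro v hvφ hv0 χ hv
    obtain ⟨z₀, hz₀⟩ : ∃ z, χ z ≠ 0 := by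
      by_contra! hχ
      obtain ⟨a, rfl⟩ := (hψ v).1 fun z hz => by
        simpa only [hχ, zero_smul, Units.val_mk0] using hv (Units.mk0 z hz)
      rw [dotProduct_smul, smul_eq_zero] at hvφ
      exact hv0 (by rw [hvφ.resolve_right overlap, zero_smul])
    exact finite_zeros_of_joint_eigenvalue trig hv0 hv hz₀
  have finite_units : {z : ℂˣ | (T z).toLin'.charpoly.rootMultiplicity 0 ≠ 1}.Finite :=
    finite_charpoly_rootMultiplicity_zero_ne_one (φ := dotProductBilin ℂ ℂ φ) (ψ := ψ)
      (fun u v => (commute u v u.ne_zero v.ne_zero).map Matrix.toLinAlgEquiv')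
      (fun z => LinearMap.ext fun v => by simp [Matrix.dotProduct_mulVec, hφ z z.ne_zero])
      (fun z => by rw [Matrix.toLin'_apply, hψ₀ z]) (by simpa using overlap)
      (by simpa using finite_zeros)
  refine (finite_units.image Units.val).subset fun z ⟨hz, hmult⟩ => ⟨Units.mk0 z hz, ?_, rfl⟩
  simpa using hmult

end SimpleEigenvalue

/-! ### The overlap of the null vectors -/

section Components

variable {N : ℕ} {q : ℂ} {w : Fin N → ℂ}

/-- The factor of site `i` at height `m` in the components of the left null vector. -/
noncomputable def leftFactor (q : ℂ) (w : Fin N → ℂ) (i : Fin N) (m : ℕ) : ℂ :=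
  ∏ j, br (q ^ (1 - (m : ℤ)) * w i / w j) / br (q * w i / w j)

/-- The factor of site `i` at height `m` in the components of the right null vector. -/
noncomputable def rightFactor (q : ℂ) (w : Fin N → ℂ) (i : Fin N) (m : ℕ) : ℂ :=
  ∏ j, br (q ^ (2 * ((m : ℤ) - 1)) * w i / w j) / br (q ^ (-2 : ℤ) * w i / w j)

theorem leftFactor_zero (hq : q ≠ 0) (hq4 : q ^ 4 ≠ 1) (hw : GenericInhom q w) (i : Fin N) :
    leftFactor q w i 0 = 1 :=
  Finset.prod_eq_one fun j _ => by
    rw [Nat.cast_zero, sub_zero, zpow_one, div_self (hw.br_mul_div_ne_zero hq hq4 i j)]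

theorem leftFactor_one {i : Fin N} (hwi : w i ≠ 0) : leftFactor q w i 1 = 0 :=
  Finset.prod_eq_zero (Finset.mem_univ i) <| by
    rw [Nat.cast_one, sub_self, zpow_zero, one_mul, div_self hwi, br_one, zero_div]

theorem leftFactor_two (i : Fin N) :
    leftFactor q w i 2 = ∏ j, br (q⁻¹ * w i / w j) / br (q * w i / w j) := by
  norm_num [leftFactor]

theorem rightFactor_zero (hq : q ≠ 0) (hq4 : q ^ 4 ≠ 1) (hw : GenericInhom q w) (i : Fin N) :
    rightFactor q w i 0 = 1 :=
  Finset.prod_eq_one fun j _ => by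
    rw [Nat.cast_zero, zero_sub, mul_neg, mul_one,
      div_self (hw.br_zpow_mul_div_ne_zero_of_dvd hq hq4 (by norm_num) i j)]

theorem rightFactor_one {i : Fin N} (hwi : w i ≠ 0) : rightFactor q w i 1 = 0 :=
  Finset.prod_eq_zero (Finset.mem_univ i) <| by
    rw [Nat.cast_one, sub_self, mul_zero, zpow_zero, one_mul, div_self hwi, br_one, zero_div]

theorem rightFactor_two (i : Fin N) :
    rightFactor q w i 2 = ∏ j, br (q ^ 2 * w i / w j) / br ((q ^ 2)⁻¹ * w i / w j) := by
  norm_num [rightFactor]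

theorem aFun_mul_leftFactor_two (hq : q ≠ 0) (hq4 : q ^ 4 ≠ 1) (hw : GenericInhom q w)
    (i : Fin N) : aFun q w (w i) * leftFactor q w i 2 = dFun q w (w i) := by
  rw [leftFactor_two, aFun, dFun, ← Finset.prod_mul_distrib]
  exact Finset.prod_congr rfl fun j _ => mul_div_cancel₀ _ (hw.br_mul_div_ne_zero hq hq4 i j)

theorem dFun_mul_rightFactor_two (hq : q ≠ 0) (hq4 : q ^ 4 ≠ 1) (hw : GenericInhom q w)
    (i : Fin N) : dFun q w (q⁻¹ * w i) * rightFactor q w i 2 = aFun q w (q * w i) := by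
  rw [rightFactor_two, aFun, dFun, ← Finset.prod_mul_distrib]
  refine Finset.prod_congr rfl fun j _ => ?_
  rw [← mul_assoc q⁻¹, ← mul_inv, ← mul_assoc, ← sq,
    mul_div_cancel₀ _ (hw.br_sq_inv_mul_div_ne_zero hq hq4 i j)]

end Components

section Overlap

variable {N : ℕ} {q : ℂ} {w : Fin N → ℂ}

/-- The factor that two sites, the first one with height `2`, contribute to the product of the
components of the two null vectors. -/
noncomputable def pairWeight (q x y : ℂ) : ℂ :=
  br (q⁻¹ * x / y) / br (q * x / y) * (br (q ^ 2 * x / y) / br ((q ^ 2)⁻¹ * x / y))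

/-- The factor that two sites with heights `2` and `0` contribute to the overlap of the two null
vectors. -/
noncomputable def overlapFactor (q x y : ℂ) : ℂ :=
  br (q⁻¹ * x / y) * br (q ^ 2 * x / y) / (br (q * x / y) * br (x / y))

theorem GenericInhom.pairWeight_mul_swap (hq : q ≠ 0) (hq4 : q ^ 4 ≠ 1) (hw : GenericInhom q w)
    (i j : Fin N) : pairWeight q (w i) (w j) * pairWeight q (w j) (w i) = 1 := by
  have hij := hw.br_mul_div_ne_zero hq hq4 i j
  have hji := hw.br_mul_div_ne_zero hq hq4 j i
  have hij2 := hw.br_sq_mul_div_ne_zero hq hq4 i j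
  have hji2 := hw.br_sq_mul_div_ne_zero hq hq4 j i
  simp only [pairWeight, br_inv_mul_div]
  field_simp

theorem GenericInhom.pairWeight_self (hq : q ≠ 0) (hq4 : q ^ 4 ≠ 1) (hw : GenericInhom q w)
    (i : Fin N) : pairWeight q (w i) (w i) = 1 := by
  have hii := hw.br_mul_div_ne_zero hq hq4 i i
  have hii2 := hw.br_sq_mul_div_ne_zero hq hq4 i i
  simp only [pairWeight, br_inv_mul_div]
  field_simp

theorem GenericInhom.pairWeight_div_normFactor (hq : q ≠ 0) (hq4 : q ^ 4 ≠ 1)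
    (hw : GenericInhom q w) (i j : Fin N) :
    pairWeight q (w i) (w j) / normFactor q (w i) (w j) = overlapFactor q (w i) (w j) := by
  have hij := hw.br_sq_inv_mul_div_ne_zero hq hq4 i j
  rw [pairWeight, normFactor, overlapFactor, ← mul_div_assoc, div_div_div_cancel_right₀ hij,
    div_mul_eq_mul_div, div_div]

theorem prod_leftFactor_mul_prod_rightFactor (hq : q ≠ 0) (hq4 : q ^ 4 ≠ 1)
    (hw : GenericInhom q w) (I : Finset (Fin N)) :
    (∏ i, leftFactor q w i (natHeights (extremeHeights I) i)) *
        ∏ i, rightFactor q w i (natHeights (extremeHeights I) i) =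
      cutProd (fun i k => pairWeight q (w i) (w k)) I := by
  have site (i : Fin N) : leftFactor q w i (natHeights (extremeHeights I) i) *
      rightFactor q w i (natHeights (extremeHeights I) i) =
        if i ∈ I then ∏ j, pairWeight q (w i) (w j) else 1 := by
    rw [natHeights_extreme]
    split_ifs
    · simp only [leftFactor_two, rightFactor_two, pairWeight, Finset.prod_mul_distrib]
    · rw [leftFactor_zero hq hq4 hw, rightFactor_zero hq hq4 hw, one_mul]
  rw [← prod_prod_eq_cutProd (hw.pairWeight_mul_swap hq hq4) (hw.pairWeight_self hq hq4),
    ← Finset.prod_mul_distrib, Finset.prod_congr rfl fun i _ => site i, Finset.prod_ite_mem,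
    Finset.univ_inter]

theorem HeightPair.dotProduct_eq_sum_cutProd {n : Type*} [Fintype n] [DecidableEq n]
    {A B C D : ℂ → Matrix n n ℂ} {c e : ℂ → ℂ} {K L : (Fin N → ℕ) → n → ℂ}
    (S : HeightPair q w A B C D c e K L)
    (hn : Fintype.card (Fin N → Fin 3) = Fintype.card n) {x y : n → ℂ}
    (hx : ∀ h ≤ 2, x ⬝ᵥ K h = ∏ i, leftFactor q w i (h i))
    (hy : ∀ h ≤ 2, y ⬝ᵥ L h = ∏ i, rightFactor q w i (h i)) :
    x ⬝ᵥ y = ∑ I : Finset (Fin N), cutProd (fun i k => overlapFactor q (w i) (w k)) I := by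
  obtain ⟨hq, hq4, hw⟩ := And.intro S.ket.q_ne_zero
    (And.intro S.ket.q_pow_four_ne_one S.ket.genericInhom)
  have term (I : Finset (Fin N)) :
      (x ⬝ᵥ K (natHeights (extremeHeights I))) * (L (natHeights (extremeHeights I)) ⬝ᵥ y) /
          (L (natHeights (extremeHeights I)) ⬝ᵥ K (natHeights (extremeHeights I))) =
        cutProd (fun i k => overlapFactor q (w i) (w k)) I := by
    rw [hx _ (natHeights_le_two _), dotProduct_comm (L _) y, hy _ (natHeights_le_two _),
      prod_leftFactor_mul_prod_rightFactor hq hq4 hw, S.norm_extreme]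
    simp only [cutProd, ← Finset.prod_div_distrib, hw.pairWeight_div_normFactor hq hq4]
  rw [S.biorthogonal.dotProduct_eq_sum hn]
  symm
  refine Finset.sum_of_injOn extremeHeights extremeHeights_injective.injOn
    (fun _ _ => Finset.mem_univ _) (fun h _ hh => ?_) fun I _ => (term I).symm
  obtain ⟨i, hi⟩ : ∃ i, h i = 1 := by
    by_contra! hne
    obtain ⟨I, rfl⟩ := exists_extremeHeights_eq hne
    exact hh (Set.mem_image_of_mem _ (Finset.mem_coe.2 (Finset.mem_univ I)))
  have component_eq_zero : x ⬝ᵥ K (natHeights h) = 0 := by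
    rw [hx _ (natHeights_le_two h)]
    refine Finset.prod_eq_zero (Finset.mem_univ i) ?_
    rw [natHeights, hi]
    exact leftFactor_one (hw.1 i)
  rw [component_eq_zero, zero_mul, zero_div]

end Overlap

section OverlapPolynomial

variable {N : ℕ} {q : ℂ}

/-- The numerator of `overlapFactor` as a polynomial. -/
def overlapNum {R : Type*} [CommRing R] (a x y : R) : R :=
  (x ^ 2 - a ^ 2 * y ^ 2) * (a ^ 4 * x ^ 2 - y ^ 2)

/-- The denominator of `overlapFactor` as a polynomial. -/
def overlapDen {R : Type*} [CommRing R] (a x y : R) : R :=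
  a ^ 2 * (a ^ 2 * x ^ 2 - y ^ 2) * (x ^ 2 - y ^ 2)

theorem br_mul_div_eq {a x y : ℂ} (ha : a ≠ 0) (hx : x ≠ 0) (hy : y ≠ 0) :
    br (a * x / y) = (a ^ 2 * x ^ 2 - y ^ 2) / (a * x * y) := by
  rw [br]
  field_simp

theorem overlapFactor_eq {x y : ℂ} (hq : q ≠ 0) (hx : x ≠ 0) (hy : y ≠ 0) :
    overlapFactor q x y = overlapNum q x y / overlapDen q x y := by
  rw [overlapFactor, ← one_mul x, br_mul_div_eq one_ne_zero hx hy, one_mul,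
    br_mul_div_eq (inv_ne_zero hq) hx hy, br_mul_div_eq hq hx hy,
    br_mul_div_eq (pow_ne_zero 2 hq) hx hy, overlapNum, overlapDen]
  field_simp

theorem overlapFactor_swap (q x y : ℂ) : overlapFactor q y x = overlapFactor q⁻¹ x y := by
  rw [overlapFactor, overlapFactor, inv_inv, inv_pow, br_inv_mul_div q y, br_inv_mul_div q x,
    br_inv_mul_div (q ^ 2) x, ← inv_div y x, br_inv, mul_neg, neg_mul_neg, neg_mul]

/-- The overlap of the null vectors, multiplied by the common denominator of its terms. -/
noncomputable def overlapPoly (N : ℕ) (q : ℂ) : MvPolynomial (Fin N) ℂ :=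
  ∑ I : Finset (Fin N), ∏ p ∈ (Finset.univ : Finset (Fin N)).offDiag,
    if p.1 ∈ I ∧ p.2 ∉ I then
      overlapNum (MvPolynomial.C q) (MvPolynomial.X p.1) (MvPolynomial.X p.2)
    else overlapDen (MvPolynomial.C q) (MvPolynomial.X p.1) (MvPolynomial.X p.2)

theorem eval_overlapPoly {w : Fin N → ℂ} (hq : q ≠ 0) (hw : ∀ i, w i ≠ 0)
    (hden : ∀ i k, i ≠ k → overlapDen q (w i) (w k) ≠ 0) :
    MvPolynomial.eval w (overlapPoly N q) =
      (∏ p ∈ (Finset.univ : Finset (Fin N)).offDiag, overlapDen q (w p.1) (w p.2)) *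
        ∑ I : Finset (Fin N), cutProd (fun i k => overlapFactor q (w i) (w k)) I := by
  rw [overlapPoly, map_sum, Finset.mul_sum]
  refine Finset.sum_congr rfl fun I _ => ?_
  rw [map_prod, cutProd_eq_prod_offDiag, ← Finset.prod_mul_distrib]
  refine Finset.prod_congr rfl fun p hp => ?_
  split_ifs
  · rw [overlapFactor_eq hq (hw _) (hw _),
      mul_div_cancel₀ _ (hden _ _ (Finset.mem_offDiag.1 hp).2.2)]
    simp [overlapNum]
  · simp [overlapDen]

open Filter Topology

theorem tendsto_overlapFactor_pow (hq : q ≠ 0) {i k : ℕ} (hik : i ≠ k) :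
    Tendsto (fun t : ℂ => overlapFactor q (t ^ i) (t ^ k)) (𝓝[≠] 0) (𝓝 1) := by
  wlog hlt : i < k generalizing q i k
  · simp only [overlapFactor_swap q (_ ^ k)]
    exact this (inv_ne_zero hq) hik.symm (hik.lt_or_gt.resolve_left hlt)
  have limit : Tendsto (fun t : ℂ => overlapNum q 1 (t ^ (k - i)) / overlapDen q 1 (t ^ (k - i)))
      (𝓝 0) (𝓝 1) := by
    have hki : k - i ≠ 0 := Nat.sub_ne_zero_of_lt hlt
    have value : overlapNum q 1 ((0 : ℂ) ^ (k - i)) / overlapDen q 1 (0 ^ (k - i)) = 1 := by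
      simp only [overlapNum, overlapDen, zero_pow hki]
      field_simp
      ring
    have hcont : ContinuousAt
        (fun t : ℂ => overlapNum q 1 (t ^ (k - i)) / overlapDen q 1 (t ^ (k - i))) 0 := by
      simp only [overlapNum, overlapDen]
      exact ContinuousAt.div (by fun_prop) (by fun_prop) (by simp [hq, hki])
    simpa only [ContinuousAt, value] using hcont
  refine (limit.mono_left nhdsWithin_le_nhds).congr' ?_
  filter_upwards [self_mem_nhdsWithin] with t ht
  have ht0 : t ≠ 0 := ht
  obtain ⟨m, rfl⟩ := Nat.exists_eq_add_of_le hlt.le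
  rw [overlapFactor_eq hq (pow_ne_zero _ ht0) (pow_ne_zero _ ht0),
    ← mul_div_mul_left _ _ (pow_ne_zero (4 * i) ht0), Nat.add_sub_cancel_left]
  congr 1 <;> simp only [overlapNum, overlapDen] <;> ring

/-- At `w i = t ^ i` every term of the overlap tends to `1` as `t → 0`. -/
theorem exists_sum_cutProd_overlapFactor_ne_zero (N : ℕ) (hq : q ≠ 0) :
    ∃ w : Fin N → ℂ, (∀ i, w i ≠ 0) ∧ (∀ i k, i ≠ k → overlapDen q (w i) (w k) ≠ 0) ∧
      ∑ I : Finset (Fin N), cutProd (fun i k => overlapFactor q (w i) (w k)) I ≠ 0 := by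
  have factor_lim (i k : Fin N) (hik : i ≠ k) :
      Tendsto (fun t : ℂ => overlapFactor q (t ^ (i : ℕ)) (t ^ (k : ℕ))) (𝓝[≠] 0) (𝓝 1) :=
    tendsto_overlapFactor_pow hq (Fin.val_ne_of_ne hik)
  have sum_lim : Tendsto (fun t : ℂ => ∑ I : Finset (Fin N),
      cutProd (fun i k : Fin N => overlapFactor q (t ^ (i : ℕ)) (t ^ (k : ℕ))) I) (𝓝[≠] 0)
      (𝓝 (∑ I : Finset (Fin N), cutProd (fun _ _ => 1) I)) :=
    tendsto_finsetSum _ fun I _ => tendsto_finsetProd _ fun i hi =>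
      tendsto_finsetProd _ fun k hk =>
        factor_lim i k (ne_of_mem_of_not_mem hi (Finset.mem_compl.1 hk))
  have lim_ne_zero : ∑ I : Finset (Fin N), cutProd (fun _ _ => 1) I ≠ 0 := by simp [cutProd]
  have sum_ne_zero := sum_lim.eventually_ne lim_ne_zero
  have factor_ne_zero : ∀ᶠ t : ℂ in 𝓝[≠] 0, ∀ i k : Fin N, i ≠ k →
      overlapFactor q (t ^ (i : ℕ)) (t ^ (k : ℕ)) ≠ 0 := by
    simp only [eventually_all]
    exact fun i k hik => (factor_lim i k hik).eventually_ne one_ne_zero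
  obtain ⟨t, hsum, hfactor, ht⟩ :=
    (sum_ne_zero.and (factor_ne_zero.and self_mem_nhdsWithin)).exists
  have hw (i : Fin N) : t ^ (i : ℕ) ≠ 0 := pow_ne_zero _ ht
  refine ⟨fun i => t ^ (i : ℕ), hw, fun i k hik hden => hfactor i k hik ?_, hsum⟩
  rw [overlapFactor_eq hq (hw i) (hw k), hden, div_zero]

theorem overlapPoly_ne_zero (N : ℕ) (hq : q ≠ 0) : overlapPoly N q ≠ 0 := by
  obtain ⟨w, hw, hden, hsum⟩ := exists_sum_cutProd_overlapFactor_ne_zero N hq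
  intro h
  have heval := eval_overlapPoly hq hw hden
  rw [h, map_zero] at heval
  refine mul_ne_zero (Finset.prod_ne_zero_iff.2 fun p hp => ?_) hsum heval.symm
  exact hden _ _ (Finset.mem_offDiag.1 hp).2.2

theorem GenericInhom.overlapDen_ne_zero {w : Fin N → ℂ} (hq : q ≠ 0) (hw : GenericInhom q w)
    {i k : Fin N} (hik : i ≠ k) : overlapDen q (w i) (w k) ≠ 0 := by
  have hsq : q ^ 2 * w i ^ 2 ≠ w k ^ 2 := fun h =>
    hw.2 k i hik.symm 1 (by norm_num) (by exact_mod_cast h.symm)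
  have hne : w i ^ 2 ≠ w k ^ 2 := by simpa using hw.2 i k hik 0 (by norm_num)
  exact mul_ne_zero (mul_ne_zero (pow_ne_zero _ hq) (sub_ne_zero.2 hsq)) (sub_ne_zero.2 hne)

end OverlapPolynomial

/-! ### The transfer matrix -/

section Transfer

variable {N : ℕ} {q s : ℂ} {w : Fin N → ℂ}

theorem transferAD_mem_trigPoly (σ τ : Conf N) :
    (fun z => transferAD q s w z σ τ) ∈ trigPoly N := by
  simp only [transferAD_eq]
  exact (trigPoly N).smul_mem Complex.I
    ((trigPoly N).add_mem (opB_mem_trigPoly σ τ) (opC_mem_trigPoly σ τ))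

theorem transferAD_neg {z : ℂ} (hz : z ≠ 0) :
    transferAD q s w (-z) = ((-1 : ℂ) ^ (N + 1)) • transferAD q s w z := by
  ext σ τ
  exact trigPoly_apply_neg (transferAD_mem_trigPoly σ τ) hz

theorem opC_opB_commutator_symm (hq : q ≠ 0) (hs : s ^ 2 = br q * br (q ^ 2))
    (hw : ∀ i, w i ≠ 0) {u v : ℂ} (hu : u ≠ 0) (hv : v ≠ 0) (huv : u ^ 2 ≠ v ^ 2) :
    opC q s w u * opB q s w v - opB q s w v * opC q s w u =
      opC q s w v * opB q s w u - opB q s w u * opC q s w v := by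
  have nodup : (List.finRange N).reverse.Nodup := List.nodup_reverse.2 (List.nodup_finRange N)
  have CB_uv := (partialMonodromy_exchange hq hs hw hu hv nodup).CB
  have CB_vu := (partialMonodromy_exchange hq hs hw hv hu nodup).CB
  rw [← inv_div, br_inv, neg_smul, neg_eq_iff_eq_neg, ← smul_neg, neg_sub] at CB_vu
  simp only [opB_eq, opC_eq]
  exact smul_right_injective _ (br_div_ne_zero hu hv huv) (CB_uv.trans CB_vu.symm)

theorem transferAD_commute (hq : q ≠ 0) (hq4 : q ^ 4 ≠ 1) (hs : s ^ 2 = br q * br (q ^ 2))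
    (hw : ∀ i, w i ≠ 0) (u v : ℂ) (hu : u ≠ 0) (hv : v ≠ 0) :
    Commute (transferAD q s w u) (transferAD q s w v) := by
  by_cases huv : u ^ 2 = v ^ 2
  · rcases sq_eq_sq_iff_eq_or_eq_neg.1 huv with rfl | rfl
    · exact Commute.refl _
    · rw [transferAD_neg hv]
      exact (Commute.refl _).smul_left _
  · have hB := (opB_commute hq hq4 hs hw u v hu hv).eq
    have hC := (opC_commute hq hq4 hs hw u v hu hv).eq
    have hCB := opC_opB_commutator_symm hq hs hw hu hv huv
    rw [transferAD_eq, transferAD_eq]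
    refine Commute.smul_left (Commute.smul_right ?_ _) _
    rw [Commute, SemiconjBy, ← sub_eq_zero, ← sub_eq_zero.2 hCB, mul_add, add_mul, add_mul,
      mul_add, add_mul, add_mul, hB, hC]
    abel

theorem exists_leftNullVector (hq : q ≠ 0) (hq4 : q ^ 4 ≠ 1) (hs : s ^ 2 = br q * br (q ^ 2))
    (hw : GenericInhom q w) :
    ∃ ψ : Conf N → ℂ, ψ ≠ 0 ∧
      (∀ φ : Conf N → ℂ, (∀ z, z ≠ 0 → φ ᵥ* transferAD q s w z = 0) ↔ ∃ c : ℂ, φ = c • ψ) ∧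
      ∀ h ≤ 2, ψ ⬝ᵥ ketState q s w h = ∏ i, leftFactor q w i (h i) := by
  obtain ⟨ψ, hψ0, hψ, overlap⟩ := (heightPair hq hq4 hs hw).exists_leftKernel rfl
    (leftFactor_zero hq hq4 hw) (fun i => leftFactor_one (hw.1 i)) fun i => by
      rw [inv_mul_cancel_left₀ hq, aFun_mul_leftFactor_two hq hq4 hw]
  refine ⟨ψ, hψ0, fun φ => ?_, overlap⟩
  simp only [← hψ, transferAD_eq, Matrix.vecMul_smul, smul_eq_zero, Complex.I_ne_zero, false_or]

theorem exists_rightNullVector (hq : q ≠ 0) (hq4 : q ^ 4 ≠ 1) (hs : s ^ 2 = br q * br (q ^ 2))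
    (hw : GenericInhom q w) :
    ∃ ψ : Conf N → ℂ, ψ ≠ 0 ∧
      (∀ v : Conf N → ℂ, (∀ z, z ≠ 0 → transferAD q s w z *ᵥ v = 0) ↔ ∃ c : ℂ, v = c • ψ) ∧
      ∀ h ≤ 2, ψ ⬝ᵥ braState q s w h = ∏ i, rightFactor q w i (h i) := by
  obtain ⟨ψ, hψ0, hψ, overlap⟩ := (heightPair hq hq4 hs hw).dual.exists_leftKernel rfl
    (rightFactor_zero hq hq4 hw) (fun i => rightFactor_one (hw.1 i))
    (dFun_mul_rightFactor_two hq hq4 hw)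
  refine ⟨ψ, hψ0, fun v => ?_, overlap⟩
  simp only [← hψ, transferAD_eq, Matrix.smul_mulVec, smul_eq_zero, Complex.I_ne_zero, false_or,
    ← Matrix.transpose_add, Matrix.vecMul_transpose, add_comm (opC _ _ _ _)]

theorem dotProduct_nullVectors_ne_zero (hq : q ≠ 0) (hq4 : q ^ 4 ≠ 1)
    (hs : s ^ 2 = br q * br (q ^ 2)) (hw : GenericInhom q w)
    (hP : MvPolynomial.eval w (overlapPoly N q) ≠ 0) {φ ψ : Conf N → ℂ}
    (hφ : ∀ h ≤ 2, φ ⬝ᵥ ketState q s w h = ∏ i, leftFactor q w i (h i))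
    (hψ : ∀ h ≤ 2, ψ ⬝ᵥ braState q s w h = ∏ i, rightFactor q w i (h i)) : φ ⬝ᵥ ψ ≠ 0 := by
  rw [(heightPair hq hq4 hs hw).dotProduct_eq_sum_cutProd rfl hφ hψ]
  rw [eval_overlapPoly hq hw.1 fun i k hik => hw.overlapDen_ne_zero hq hik] at hP
  exact right_ne_zero_of_mul hP

theorem biorthogonal_heightBra_heightKet (hq : q ≠ 0) (hq4 : q ^ 4 ≠ 1)
    (hs : s ^ 2 = br q * br (q ^ 2)) (hw : GenericInhom q w) :
    Biorthogonal (heightBra q s w) (heightKet q s w) := by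
  simpa only [← heightBra_eq hq hq4 hs hw.1, ← heightKet_eq] using
    (heightPair hq hq4 hs hw).biorthogonal

end Transfer

end TenVertex

theorem mainTheorem9 (N : ℕ) (q s : ℂ) (hq0 : q ≠ 0) (hq4 : q ^ 4 ≠ 1)
    (hs : s ^ 2 = TenVertex.br q * TenVertex.br (q ^ 2)) :
    (∀ w : Fin N → ℂ, TenVertex.GenericInhom q w →
      -- the height states and the dual height states are bases
      LinearIndependent ℂ (TenVertex.heightKet q s w) ∧
      Submodule.span ℂ (Set.range (TenVertex.heightKet q s w)) = ⊤ ∧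
      LinearIndependent ℂ (TenVertex.heightBra q s w) ∧
      Submodule.span ℂ (Set.range (TenVertex.heightBra q s w)) = ⊤ ∧
      -- the left eigenvector
      (∃ ψL : TenVertex.Conf N → ℂ, ψL ≠ 0 ∧
        (∀ φ : TenVertex.Conf N → ℂ,
          (∀ z : ℂ, z ≠ 0 → φ ᵥ* TenVertex.transferAD q s w z = 0) ↔ ∃ c : ℂ, φ = c • ψL) ∧
        ∀ h : Fin N → Fin 3,
          ψL ⬝ᵥ TenVertex.heightKet q s w h =
            ∏ i, ∏ j, TenVertex.br (q ^ (1 - ((h i : ℕ) : ℤ)) * w i / w j) /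
              TenVertex.br (q * w i / w j)) ∧
      -- the right eigenvector
      (∃ ψR : TenVertex.Conf N → ℂ, ψR ≠ 0 ∧
        (∀ v : TenVertex.Conf N → ℂ,
          (∀ z : ℂ, z ≠ 0 → TenVertex.transferAD q s w z *ᵥ v = 0) ↔ ∃ c : ℂ, v = c • ψR) ∧
        ∀ h : Fin N → Fin 3,
          TenVertex.heightBra q s w h ⬝ᵥ ψR =
            ∏ i, ∏ j, TenVertex.br (q ^ (2 * (((h i : ℕ) : ℤ) - 1)) * w i / w j) /
              TenVertex.br (q ^ (-2 : ℤ) * w i / w j))) ∧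
    -- the eigenvalue 0 of the single matrices is simple
    (∃ P : MvPolynomial (Fin N) ℂ, P ≠ 0 ∧
      ∀ w : Fin N → ℂ, TenVertex.GenericInhom q w → MvPolynomial.eval w P ≠ 0 →
        {z : ℂ | z ≠ 0 ∧
          (TenVertex.transferAD q s w z).charpoly.rootMultiplicity 0 ≠ 1}.Finite) := by
  refine ⟨fun w hw => ?_, TenVertex.overlapPoly N q, TenVertex.overlapPoly_ne_zero N hq0,
    fun w hw hP => ?_⟩
  · have heights := TenVertex.biorthogonal_heightBra_heightKet hq0 hq4 hs hw
    obtain ⟨ψL, hψL0, left_null, left_components⟩ :=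
      TenVertex.exists_leftNullVector hq0 hq4 hs hw
    obtain ⟨ψR, hψR0, right_null, right_components⟩ :=
      TenVertex.exists_rightNullVector hq0 hq4 hs hw
    refine ⟨heights.symm.linearIndependent, heights.symm.span_eq_top rfl,
      heights.linearIndependent, heights.span_eq_top rfl,
      ⟨ψL, hψL0, left_null, fun h => left_components _ (TenVertex.natHeights_le_two h)⟩,
      ψR, hψR0, right_null, fun h => ?_⟩
    rw [dotProduct_comm, TenVertex.heightBra_eq hq0 hq4 hs hw.1]
    exact right_components _ (TenVertex.natHeights_le_two h)
  · obtain ⟨ψL, -, left_null, left_components⟩ := TenVertex.exists_leftNullVector hq0 hq4 hs hw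
    obtain ⟨ψR, -, right_null, right_components⟩ := TenVertex.exists_rightNullVector hq0 hq4 hs hw
    have overlap : ψL ⬝ᵥ ψR ≠ 0 :=
      TenVertex.dotProduct_nullVectors_ne_zero hq0 hq4 hs hw hP left_components right_components
    exact TenVertex.finite_rootMultiplicity_ne_one TenVertex.transferAD_mem_trigPoly
      (TenVertex.transferAD_commute hq0 hq4 hs hw.1)
      ((left_null ψL).2 ⟨1, (one_smul _ _).symm⟩) right_null overlap
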